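/- **Adiabatic Theorem for Noisy Hamiltonian Evolutions (AT-Noise).** Let $E$ be a complex Hilbert space, let $D\subseteq E$ be a dense subspace, and let $T\subseteq(0,\infty)$ be a set of run-times (for instance $T=(0,\infty)$). Let $\mathcal H(s)$, $s\in[0,1]$, be self-adjoint operators (possibly unbounded) with common domain $D$, and let $\mathcal H_{noise}(t)$ be linear operators on $D$, defined at the real times $t\in\bigcup_{\tau\in T}[0,\tau]$. For $\tau\in T$ and $s\in[0,1]$ put $$\mathcal H_\tau(s)=\mathcal H(s)+\mathcal H_{noise}(s\tau),$$ and assume that $\mathcal H_\tau(s)$ is self-adjoint on $D$ and has a complete orthonormal system of eigenvectors $\psi_0^\tau(s),\psi_1^\tau(s),\dots$ (finite or countable, with at least two members) with eigenvalues $\lambda_0^\tau(s)\le\lambda_1^\tau(s)\le\cdots$. Assume that $\mathcal H$ and $\mathcal H_{noise}$ are twice differentiable in operator norm, with bounded derivatives, and that $$\Big\|\tfrac{d}{ds}\mathcal H(s)\Big\|\le c_1,\quad \Big\|\tfrac{d^2}{ds^2}\mathcal H(s)\Big\|\le c_2,\quad \Big\|\tfrac{d}{dt}\mathcal H_{noise}(t)\Big\|\le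 d_1,\quad \Big\|\tfrac{d^2}{dt^2}\mathcal H_{noise}(t)\Big\|\le d_2$$ for all such $s$ and $t$. Assume that there is a constant $\bar\gamma>0$ with $$\bar\gamma\le\lambda_1^\tau(s)-\lambda_0^\tau(s)\qquad\text{for all } s\in[0,1],\ \tau\in T.$$ Let $\phi_0(0)$ and $\phi_0(1)$ be the normalized non-degenerate ground states of $\mathcal H(0)$ and $\mathcal H(1)$, let $P(s)=|\phi_0(s)\rangle\langle\phi_0(s)|$ and $Q(s)=I-P(s)$ for $s=0,1$, and let $$\delta_0=\sqrt{1-|\langle\psi_0^\tau(0)|\phi_0(0)\rangle|^2},\qquad \delta_1=\sqrt{1-|\langle\psi_0^\tau(1)|\phi_0(1)\rangle|^2}.$$ Let $U_\tau(s)$, $s\in[0,1]$, be the unitary evolution operators solving $\frac{d}{ds}U_\tau(s)=-i\tau\,\mathcal H_\tau(s)U_\tau(s)$ (on $D$, which $U_\tau(s)$ maps into itself), with $U_\tau(0)=I$. Then, for every $\tau\in T$, $$\|Q(1)U_\tau(1)P(0)\|\le B(\tau),$$ where $$B(\tau)=\frac{8}{\bar\gamma^2}\Big[\Big(d_2+\frac{16d_1^2}{\bar\gamma}\Big)\tau+2d_1\Big(1+\frac{16c_1}{\bar\gamma}\Big)+\Big(2c_1+c_2+\frac{16c_1^2}{\bar\gamma}\Big)\frac1\tau\Big]+\delta_0+\delta_1+\delta_0\delta_1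 .$$ Moreover, a run-time $\tau\in T$ for which this bound guarantees an error tolerance $\varepsilon$, that is, for which $B(\tau)\le\varepsilon$, is bounded below and above: $$\frac{8}{\bar\gamma^2}\Big(2c_1+c_2+\frac{16c_1^2}{\bar\gamma}\Big)\le\varepsilon\,\tau \qquad\text{and}\qquad \frac{8}{\bar\gamma^2}\Big(d_2+\frac{16d_1^2}{\bar\gamma}\Big)\tau\le\varepsilon .$$ -/

import Mathlib

open Set Filter Topology

namespace Adiabatic

/-- The index set `{0, 1, 2, …}` of the eigenvalues: the natural numbers below `N`, where `N = ⊤`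
gives all of `ℕ`. -/
abbrev LevelIndex (N : ℕ∞) : Type := {j : ℕ // (j : ℕ∞) < N}

/-- A complete list of eigenstates of the (possibly unbounded) operator `A` with domain `D`: an
orthonormal Hilbert basis of eigenvectors lying in `D`, whose eigenvalues (repeated according to
multiplicity) are real and listed in nondecreasing order `λ₀ ≤ λ₁ ≤ …`. There are at least two
levels, so that a first excited state exists. -/
structure OrderedEigenbasis {E : Type*} [NormedAddCommGroup E] [InnerProductSpace ℂ E]
    {D : Submodule ℂ E} (A : D →ₗ[ℂ] E) where
  N : ℕ∞
  two_le : 2 ≤ N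
  basis : HilbertBasis (LevelIndex N) ℂ E
  energy : LevelIndex N → ℝ
  energy_mono : Monotone energy
  mem_domain : ∀ j, basis j ∈ D
  eigen : ∀ j, A ⟨basis j, mem_domain j⟩ = (energy j : ℂ) • basis j

namespace OrderedEigenbasis

/-- The index of the lowest level. -/
def zeroIndex {E : Type*} [NormedAddCommGroup E] [InnerProductSpace ℂ E] {D : Submodule ℂ E}
    {A : D →ₗ[ℂ] E} (S : OrderedEigenbasis A) : LevelIndex S.N :=
  ⟨0, lt_of_lt_of_le (by norm_num) S.two_le⟩

/-- The index of the first excited level. -/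
def oneIndex {E : Type*} [NormedAddCommGroup E] [InnerProductSpace ℂ E] {D : Submodule ℂ E}
    {A : D →ₗ[ℂ] E} (S : OrderedEigenbasis A) : LevelIndex S.N :=
  ⟨1, lt_of_lt_of_le (by norm_num) S.two_le⟩

/-- The ground state. -/
noncomputable def ground {E : Type*} [NormedAddCommGroup E] [InnerProductSpace ℂ E]
    {D : Submodule ℂ E} {A : D →ₗ[ℂ] E} (S : OrderedEigenbasis A) : E :=
  S.basis S.zeroIndex

/-- The energy gap `λ₁ - λ₀` between the ground state and the first excited state. -/
def gap {E : Type*} [NormedAddCommGroup E] [InnerProductSpace ℂ E] {D : Submodule ℂ E}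
    {A : D →ₗ[ℂ] E} (S : OrderedEigenbasis A) : ℝ :=
  S.energy S.oneIndex - S.energy S.zeroIndex

end OrderedEigenbasis

/-- `φ` is the (normalized, non-degenerate) ground state of the operator `A` with domain `D`: it is
a unit eigenvector whose eigenvalue is the minimum of the energy, and every eigenvector of that
eigenvalue is a multiple of `φ`. -/
def IsGroundState {E : Type*} [NormedAddCommGroup E] [InnerProductSpace ℂ E]
    {D : Submodule ℂ E} (A : D →ₗ[ℂ] E) (φ : E) : Prop :=
  ‖φ‖ = 1 ∧ ∃ (hφ : φ ∈ D) (e : ℝ), A ⟨φ, hφ⟩ = (e : ℂ) • φ ∧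
    (∀ x : D, e * ‖(x : E)‖ ^ 2 ≤ (inner ℂ (x : E) (A x)).re) ∧
    (∀ x : D, A x = (e : ℂ) • (x : E) → ∃ z : ℂ, (x : E) = z • φ)

/-- The orthogonal projection `|φ⟩⟨φ|` onto the line spanned by the state `φ`. -/
noncomputable def stateProj {E : Type*} [NormedAddCommGroup E] [InnerProductSpace ℂ E]
    (φ : E) : E →L[ℂ] E :=
  (Submodule.span ℂ {φ}).starProjection

/-- `√(1 - |⟨ψ|φ⟩|²)`. -/
noncomputable def stateDeviation {E : Type*} [NormedAddCommGroup E] [InnerProductSpace ℂ E]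
    (ψ φ : E) : ℝ :=
  Real.sqrt (1 - ‖inner ℂ ψ φ‖ ^ 2)

/-- The family `H(s)` of operators with common domain `D` is differentiable at `s` within `J`, in
the operator norm, with the bounded operator `H'` as derivative. (If the `H(s)` are bounded and
`D` is the whole space, this is the ordinary derivative in the space of bounded operators.) -/
def HasOpDerivWithinAt {E : Type*} [NormedAddCommGroup E] [InnerProductSpace ℂ E]
    {D : Submodule ℂ E} (H : ℝ → D →ₗ[ℂ] E) (H' : E →L[ℂ] E) (J : Set ℝ) (s : ℝ) : Prop :=
  ∀ ε : ℝ, 0 < ε → ∀ᶠ r in 𝓝[J] s, ∀ x : D,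
    ‖H r x - H s x - ((r - s : ℝ) : ℂ) • H' (x : E)‖ ≤ ε * |r - s| * ‖(x : E)‖

/-- `H` is twice differentiable (in the operator norm) on `J`, with first derivative `H'` bounded
in norm by `b₁` and second derivative `H''` bounded in norm by `b₂`. -/
structure TwiceDiffBounded {E : Type*} [NormedAddCommGroup E] [InnerProductSpace ℂ E]
    {D : Submodule ℂ E} (H : ℝ → D →ₗ[ℂ] E) (H' H'' : ℝ → E →L[ℂ] E) (J : Set ℝ)
    (b₁ b₂ : ℝ) : Prop where
  hasDeriv : ∀ s ∈ J, HasOpDerivWithinAt H (H' s) J s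
  hasDeriv₂ : ∀ s ∈ J, HasDerivWithinAt H' (H'' s) J s
  norm_deriv_le : ∀ s ∈ J, ‖H' s‖ ≤ b₁
  norm_deriv₂_le : ∀ s ∈ J, ‖H'' s‖ ≤ b₂

/-- The Hamiltonian `H_τ(s) = H(s) + H_noise(s τ)`. -/
def noisyHamiltonian {E : Type*} [NormedAddCommGroup E] [InnerProductSpace ℂ E]
    {D : Submodule ℂ E} (H Hnoise : ℝ → D →ₗ[ℂ] E) (τ s : ℝ) : D →ₗ[ℂ] E :=
  H s + Hnoise (s * τ)

/-- The real times `t = s τ` with `0 ≤ s ≤ 1` that occur for the run-times `τ` in `T`. -/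
def realTimes (T : Set ℝ) : Set ℝ := ⋃ τ ∈ T, Icc 0 τ

/-- `U` is the unitary evolution operator of `s ↦ H(s)`, `0 ≤ s ≤ 1`, with run-time `τ`: the unitary
solution of `dU/ds = -i τ H(s) U(s)`, `U(0) = I`, where the equation is read on the domain `D`. -/
structure IsEvolution {E : Type*} [NormedAddCommGroup E] [InnerProductSpace ℂ E]
    [CompleteSpace E] {D : Submodule ℂ E} (τ : ℝ) (H : ℝ → D →ₗ[ℂ] E)
    (U : ℝ → E →L[ℂ] E) : Prop where
  zero : U 0 = 1
  unitary : ∀ s ∈ Icc (0 : ℝ) 1, U s ∈ unitary (E →L[ℂ] E)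
  schrodinger : ∀ s ∈ Icc (0 : ℝ) 1, ∀ x ∈ D, ∃ hs : U s x ∈ D,
    HasDerivWithinAt (fun r => U r x) (-(Complex.I * (τ : ℂ)) • H s ⟨U s x, hs⟩) (Icc 0 1) s

/-- The right-hand side of the error estimate. -/
noncomputable def noiseBound (c₁ c₂ d₁ d₂ γ δ₀ δ₁ τ : ℝ) : ℝ :=
  8 / γ ^ 2 * ((d₂ + 16 * d₁ ^ 2 / γ) * τ + 2 * d₁ * (1 + 16 * c₁ / γ)
    + (2 * c₁ + c₂ + 16 * c₁ ^ 2 / γ) * (1 / τ)) + δ₀ + δ₁ + δ₀ * δ₁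

end Adiabatic

/-! Write `P` for the projection onto the instantaneous ground state of `A = H_τ`, `e` for its
energy, `S` for the reduced resolvent (the inverse of `A - e` on the complement of the ground state,
zero on the ground state), and `u` for the evolved state. The gap gives `‖S‖ ≤ 1/γ`. Since `A`
commutes with `P`, the population `p = ⟨u, P u⟩` satisfies `p' = -2 Re⟨u, P A' S u⟩`, with no factor
`τ`, but also with no smallness.

The smallness comes from an integration by parts. The operator `X = P A' S²` solves the commutator
equation `X A - A X = P A' S`, so the Schrödinger equation makes `-p + (2/τ) Im⟨u, X u⟩` a function
with derivative `(2/τ) Im⟨u, X' u⟩`. A plain bound would give only `‖(1-P)u‖² = O(1/τ)`. However `X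
P = 0` and `X' P = P A' S³ A' P` is self-adjoint, so both imaginary parts are bounded by a constant
times `‖(1-P)u‖`. At a time where this norm attains its maximum `M`, the result is `M² ≤ (const/τ)
M`, and one factor `M` cancels (`IsGappedFamily.norm_sub_stateProj_le`).

Since `A` is unbounded, all differentiation is done on bounded objects: exact difference identities
for `P`, `e` and `G = (A - e + γP)⁻¹` give Lipschitz bounds first and derivatives next. The theorem
follows with first and second derivative bounds `c₁ + τ d₁` and `c₂ + τ² d₂`, after the endpoint
states are exchanged at cost `δ₀ + δ₁`. -/

namespace Adiabatic

/-! ### Bounded diagonal operators in a Hilbert basis. -/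

section Diagonal

variable {E : Type*} [NormedAddCommGroup E] [InnerProductSpace ℂ E] {ι : Type*}

theorem memℓp_bounded_mul {m : ι → ℝ} {C : ℝ} (hm : ∀ i, |m i| ≤ C)
    (f : lp (fun _ : ι => ℂ) 2) : Memℓp (fun i => (m i : ℂ) * f i) 2 := by
  have hf := (lp.memℓp f).const_smul (C : ℂ)
  refine memℓp_gen ?_
  have h2 := hf.summable (by norm_num)
  refine Summable.of_nonneg_of_le (fun i => by positivity) (fun i => ?_) h2
  have hC : 0 ≤ C := (abs_nonneg _).trans (hm i)
  refine Real.rpow_le_rpow (norm_nonneg _) ?_ (by norm_num)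
  simp only [Pi.smul_apply, smul_eq_mul, norm_mul, Complex.norm_real, Real.norm_eq_abs,
    abs_of_nonneg hC]
  exact mul_le_mul_of_nonneg_right (hm i) (norm_nonneg _)

/-- A bounded operator that is diagonal, with prescribed bounded real entries, in a Hilbert
basis. -/
theorem exists_diagonal (b : HilbertBasis ι ℂ E) {m : ι → ℝ} {C : ℝ} (hC : 0 ≤ C)
    (hm : ∀ i, |m i| ≤ C) :
    ∃ G : E →L[ℂ] E, ‖G‖ ≤ C ∧ ∀ x i, inner ℂ (b i) (G x) = (m i : ℂ) * inner ℂ (b i) x := by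
  let g : E →ₗ[ℂ] E :=
    { toFun := fun x => b.repr.symm ⟨_, memℓp_bounded_mul hm (b.repr x)⟩
      map_add' := fun x y => by
        rw [← map_add]
        congr 1
        ext i
        simp only [map_add, lp.coeFn_add, Pi.add_apply, mul_add]
      map_smul' := fun c x => by
        rw [RingHom.id_apply, ← map_smul]
        congr 1
        ext i
        simp only [map_smul, lp.coeFn_smul, Pi.smul_apply, smul_eq_mul]
        ring }
  have hg : ∀ x i, inner ℂ (b i) (g x) = (m i : ℂ) * inner ℂ (b i) x := fun x i => by
    rw [← b.repr_apply_apply, ← b.repr_apply_apply]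
    simp [g]
  have hnorm : ∀ x, HasSum (fun i => ‖inner ℂ (b i) x‖ ^ 2) (‖x‖ ^ 2) := fun x => by
    have h := b.hasSum_inner_mul_inner x x
    rw [inner_self_eq_norm_sq_to_K] at h
    have h2 := Complex.hasSum_re h
    convert h2 using 1
    · ext i
      rw [← inner_conj_symm x (b i), Complex.conj_mul']
      norm_cast
    · norm_cast
  refine ⟨g.mkContinuous C fun x => ?_, g.mkContinuous_norm_le hC _, hg⟩
  refine abs_le_of_sq_le_sq' ?_ (by positivity) |>.2
  rw [mul_pow]
  refine hasSum_le (fun i => ?_) (hnorm (g x)) ((hnorm x).mul_left (C ^ 2))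
  rw [hg, norm_mul, mul_pow, Complex.norm_real, Real.norm_eq_abs]
  gcongr
  exact hm i

theorem ext_inner_basis (b : HilbertBasis ι ℂ E) {x y : E}
    (h : ∀ i, inner ℂ (b i) x = inner ℂ (b i) y) : x = y := by
  apply b.repr.injective
  ext i
  rw [b.repr_apply_apply, b.repr_apply_apply, h]

end Diagonal

/-! ### Ground state projections and the bounded inverse of `A - e + γP`. -/

variable {E : Type*} [NormedAddCommGroup E] [InnerProductSpace ℂ E]

theorem stateProj_apply {φ : E} (hφ : ‖φ‖ = 1) (x : E) :
    stateProj φ x = inner ℂ φ x • φ :=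
  Submodule.starProjection_unit_singleton ℂ hφ x

theorem norm_stateProj_le (φ : E) : ‖stateProj φ‖ ≤ 1 :=
  Submodule.starProjection_norm_le _

theorem stateProj_self (φ : E) : stateProj φ φ = φ :=
  Submodule.starProjection_eq_self_iff.2 (Submodule.mem_span_singleton_self φ)

theorem stateProj_mul_self (φ : E) : stateProj φ * stateProj φ = stateProj φ :=
  Submodule.isIdempotentElem_starProjection _

theorem isSelfAdjoint_stateProj [CompleteSpace E] (φ : E) : IsSelfAdjoint (stateProj φ) :=
  isSelfAdjoint_starProjection _

/-- `ψ` is a normalized ground state of the symmetric operator `A` with energy `e`, and `G` is the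
bounded inverse of `A - e + γ |ψ⟩⟨ψ|`, with norm at most `1 / γ`. -/
structure IsGroundResolvent [CompleteSpace E] {D : Submodule ℂ E} (A : D →ₗ[ℂ] E) (γ e : ℝ)
    (ψ : E) (G : E →L[ℂ] E) : Prop where
  norm_ground : ‖ψ‖ = 1
  ground_mem : ψ ∈ D
  eigen : A ⟨ψ, ground_mem⟩ = (e : ℂ) • ψ
  symm : ∀ x y : D, inner ℂ (A x) (y : E) = inner ℂ (x : E) (A y)
  energy_le : ∀ x : D, e * ‖(x : E)‖ ^ 2 ≤ (inner ℂ (x : E) (A x)).re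
  norm_le : ‖G‖ ≤ γ⁻¹
  selfAdjoint : IsSelfAdjoint G
  mem : ∀ x, G x ∈ D
  right_inv : ∀ x, A ⟨G x, mem x⟩ = x + (e : ℂ) • G x - (γ : ℂ) • stateProj ψ (G x)
  left_inv : ∀ z : D, G (A z - (e : ℂ) • (z : E) + (γ : ℂ) • stateProj ψ (z : E)) = z

/-- In the eigenbasis, `A - e + γP` is diagonal with entry `γ` at the ground state and entries `λ_j
- e ≥ γ` elsewhere. Adding `γP` makes it invertible on the whole space, so no restriction to a
moving complement is needed. -/
theorem OrderedEigenbasis.exists_isGroundResolvent [CompleteSpace E] {D : Submodule ℂ E}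
    {A : D →ₗ[ℂ] E} (hA : IsSelfAdjoint (LinearPMap.mk D A)) (S : OrderedEigenbasis A)
    {γ : ℝ} (hγ : 0 < γ) (hgap : γ ≤ S.gap) :
    ∃ G, IsGroundResolvent A γ (S.energy S.zeroIndex) S.ground G := by
  classical
  set e := S.energy S.zeroIndex with he
  set ψ := S.ground with hψ
  have hψ1 : ‖ψ‖ = 1 := S.basis.orthonormal.1 _
  have hdense : Dense (D : Set E) := hA.dense_domain
  have hadj : LinearPMap.adjoint (LinearPMap.mk D A) = LinearPMap.mk D A := hA
  have hsymm : ∀ x y : D, inner ℂ (A x) (y : E) = inner ℂ (x : E) (A y) := by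
    have := LinearPMap.adjoint_isFormalAdjoint (T := LinearPMap.mk D A) hdense
    rw [hadj] at this
    exact this
  have hcoef : ∀ (x : D) j, inner ℂ (S.basis j) (A x) =
      (S.energy j : ℂ) * inner ℂ (S.basis j) (x : E) := by
    intro x j
    rw [← hsymm ⟨S.basis j, S.mem_domain j⟩ x, S.eigen, inner_smul_left, Complex.conj_ofReal]
  have hzero : ∀ j, S.energy S.zeroIndex ≤ S.energy j := fun j =>
    S.energy_mono (Subtype.mk_le_mk.2 (Nat.zero_le _))
  have hone : ∀ j, j ≠ S.zeroIndex → γ ≤ S.energy j - e := fun j hj => by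
    have h1 : S.oneIndex ≤ j := by
      refine Subtype.mk_le_mk.2 (Nat.one_le_iff_ne_zero.2 fun h => hj (Subtype.ext h))
    have := S.energy_mono h1
    have h2 : γ ≤ S.energy S.oneIndex - e := hgap
    linarith
  have hP : ∀ x j, inner ℂ (S.basis j) (stateProj ψ x) =
      if j = S.zeroIndex then inner ℂ (S.basis j) x else 0 := fun x j => by
    rw [stateProj_apply hψ1, inner_smul_right, hψ, OrderedEigenbasis.ground,
      orthonormal_iff_ite.1 S.basis.orthonormal]
    split_ifs with h
    · rw [h, mul_one]
    · rw [mul_zero]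
  let β : LevelIndex S.N → ℝ := fun j => if j = S.zeroIndex then γ else S.energy j - e
  have hβ : ∀ j, γ ≤ β j := fun j => by
    by_cases h : j = S.zeroIndex
    · simp [β, h]
    · simpa [β, h] using hone j h
  have hβ0 : ∀ j, (β j : ℂ) ≠ 0 := fun j =>
    Complex.ofReal_ne_zero.2 (hγ.trans_le (hβ j)).ne'
  have hB : ∀ (z : D) j,
      inner ℂ (S.basis j) (A z - (e : ℂ) • (z : E) + (γ : ℂ) • stateProj ψ (z : E)) =
        (β j : ℂ) * inner ℂ (S.basis j) (z : E) := fun z j => by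
    rw [inner_add_right, inner_sub_right, inner_smul_right, inner_smul_right, hP, hcoef]
    by_cases h : j = S.zeroIndex
    · simp [β, h, he]
    · simp [β, h, sub_mul]
  obtain ⟨G, hG, hGc⟩ := exists_diagonal S.basis (m := fun j => (β j)⁻¹) (C := γ⁻¹)
    (inv_nonneg.2 hγ.le) (fun j => by
      rw [abs_of_pos (inv_pos.2 (hγ.trans_le (hβ j)))]
      exact inv_anti₀ hγ (hβ j))
  have hGs : ∀ x y, inner ℂ (G x) y = inner ℂ x (G y) := fun x y => by
    rw [← S.basis.tsum_inner_mul_inner, ← S.basis.tsum_inner_mul_inner]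
    refine tsum_congr fun j => ?_
    rw [hGc, ← inner_conj_symm, hGc]
    simp only [map_mul, Complex.conj_ofReal, inner_conj_symm]
    ring
  have hleft : ∀ z : D, G (A z - (e : ℂ) • (z : E) + (γ : ℂ) • stateProj ψ (z : E)) = z := fun z =>
    ext_inner_basis S.basis fun j => by
      rw [hGc, hB, Complex.ofReal_inv, inv_mul_cancel_left₀ (hβ0 j)]
  have hPs : ∀ x y, inner ℂ (stateProj ψ x) y = inner ℂ x (stateProj ψ y) := fun x y =>
    Submodule.inner_starProjection_left_eq_right _ x y
  have hw : ∀ x, ∀ z : D, inner ℂ (x + (e : ℂ) • G x - (γ : ℂ) • stateProj ψ (G x)) (z : E)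
      = inner ℂ (G x) (A z) := fun x z => by
    have h1 : inner ℂ (G x) (A z - (e : ℂ) • (z : E) + (γ : ℂ) • stateProj ψ (z : E)) =
        inner ℂ x (z : E) := by rw [hGs, hleft]
    rw [inner_add_right, inner_sub_right, inner_smul_right, inner_smul_right] at h1
    rw [inner_sub_left, inner_add_left, inner_smul_left, inner_smul_left, hPs, ← h1]
    simp only [Complex.conj_ofReal]
    ring
  have hadjD : (LinearPMap.adjoint (LinearPMap.mk D A)).domain = D := by rw [hadj]
  -- Self-adjointness is essential here, symmetry is not enough: by `hw` the functional `z ↦ ⟨G x, A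
  -- z⟩` is bounded, so `G x` lies in the domain of the adjoint, which is `D`.
  have hmem : ∀ x, G x ∈ D := fun x => by
    rw [← hadjD]
    exact LinearPMap.mem_adjoint_domain_of_exists _ ⟨_, hw x⟩
  refine ⟨G, hψ1, S.mem_domain _, S.eigen _, hsymm, fun x => ?_, hG, ?_, hmem, fun x => ?_, hleft⟩
  · have h1 := Complex.hasSum_re (S.basis.hasSum_inner_mul_inner (x : E) (A x))
    have h2 := (Complex.hasSum_re (S.basis.hasSum_inner_mul_inner (x : E) (x : E))).mul_left e
    have h3 : (inner ℂ (x : E) (x : E)).re = ‖(x : E)‖ ^ 2 := by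
      rw [inner_self_eq_norm_sq_to_K]; norm_cast
    rw [h3] at h2
    refine hasSum_le (fun j => ?_) h2 h1
    have h4 : inner ℂ (x : E) (S.basis j) * inner ℂ (S.basis j) (x : E) =
        ((‖inner ℂ (S.basis j) (x : E)‖ ^ 2 : ℝ) : ℂ) := by
      rw [← inner_conj_symm (x : E) (S.basis j), Complex.conj_mul']
      norm_cast
    rw [hcoef, mul_left_comm, h4, Complex.re_ofReal_mul, Complex.ofReal_re]
    exact mul_le_mul_of_nonneg_right (hzero j) (by positivity)
  · exact (ContinuousLinearMap.isSelfAdjoint_iff_isSymmetric).2 hGs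
  · refine hdense.eq_of_inner_left ℂ fun z hz => ?_
    rw [hw x ⟨z, hz⟩]
    exact hsymm ⟨G x, hmem x⟩ ⟨z, hz⟩

end Adiabatic

/-! ### Exact difference identities for two operators that differ by a bounded `k`. -/

namespace Adiabatic

variable {E : Type*} [NormedAddCommGroup E] [InnerProductSpace ℂ E]

namespace IsGroundResolvent

variable [CompleteSpace E] {D : Submodule ℂ E} {A B : D →ₗ[ℂ] E} {k : E →L[ℂ] E}
  {γ e f : ℝ} {ψ χ : E} {G F : E →L[ℂ] E}

theorem stateProj_mem (hA : IsGroundResolvent A γ e ψ G) (x : E) : stateProj ψ x ∈ D := by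
  rw [stateProj_apply hA.norm_ground]
  exact D.smul_mem _ hA.ground_mem

theorem map_stateProj (hA : IsGroundResolvent A γ e ψ G) (x : E) :
    A ⟨stateProj ψ x, hA.stateProj_mem x⟩ = (e : ℂ) • stateProj ψ x := by
  have : (⟨stateProj ψ x, hA.stateProj_mem x⟩ : D) = inner ℂ ψ x • ⟨ψ, hA.ground_mem⟩ :=
    Subtype.ext (stateProj_apply hA.norm_ground x)
  rw [this, map_smul, hA.eigen, stateProj_apply hA.norm_ground, smul_comm]

theorem inner_ground_map (hA : IsGroundResolvent A γ e ψ G) (x : D) :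
    inner ℂ ψ (A x) = (e : ℂ) * inner ℂ ψ (x : E) := by
  rw [← hA.symm ⟨ψ, hA.ground_mem⟩ x, hA.eigen, inner_smul_left, Complex.conj_ofReal]

theorem stateProj_map (hA : IsGroundResolvent A γ e ψ G) (x : D) :
    stateProj ψ (A x) = (e : ℂ) • stateProj ψ (x : E) := by
  rw [stateProj_apply hA.norm_ground, stateProj_apply hA.norm_ground, hA.inner_ground_map,
    mul_smul]

theorem resolvent_mul_stateProj (hA : IsGroundResolvent A γ e ψ G) (hγ : 0 < γ) :
    G * stateProj ψ = γ⁻¹ • stateProj ψ := by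
  ext x
  have h := hA.left_inv ⟨_, hA.stateProj_mem x⟩
  have h2 : stateProj ψ (stateProj ψ x) = stateProj ψ x :=
    DFunLike.congr_fun (stateProj_mul_self ψ) x
  rw [hA.map_stateProj, sub_self, zero_add, h2, map_smul, Complex.coe_smul] at h
  change G (stateProj ψ x) = γ⁻¹ • stateProj ψ x
  exact (eq_inv_smul_iff₀ hγ.ne').2 h

theorem stateProj_mul_resolvent (hA : IsGroundResolvent A γ e ψ G) (hγ : 0 < γ) :
    stateProj ψ * G = γ⁻¹ • stateProj ψ := by
  have h := congrArg star (hA.resolvent_mul_stateProj hγ)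
  rwa [star_mul, star_smul, star_trivial γ⁻¹, (isSelfAdjoint_stateProj ψ).star_eq,
    hA.selfAdjoint.star_eq] at h

theorem isSelfAdjoint_perturbation (hk : ∀ x : D, B x = A x + k x) (hD : Dense (D : Set E))
    (hA : IsGroundResolvent A γ e ψ G) (hB : IsGroundResolvent B γ f χ F) : IsSelfAdjoint k := by
  have hk' : ∀ x : D, k x = B x - A x := fun x => by rw [hk, add_sub_cancel_left]
  refine (ContinuousLinearMap.isSelfAdjoint_iff_isSymmetric).2 fun x y => ?_
  have h1 : ∀ x y : D, inner ℂ (k x) (y : E) = inner ℂ (x : E) (k y) := fun x y => by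
    rw [hk', hk', inner_sub_left, inner_sub_right, hA.symm, hB.symm]
  have h2 : ∀ y : D, ∀ x : E, inner ℂ (k x) (y : E) = inner ℂ x (k y) := fun y x =>
    hD.induction (P := fun x => inner ℂ (k x) (y : E) = inner ℂ x (k y))
      (fun x hx => h1 ⟨x, hx⟩ y) (isClosed_eq (by fun_prop) (by fun_prop)) x
  exact hD.induction (P := fun y => inner ℂ (k x) (y : E) = inner ℂ x (k y))
      (fun y hy => h2 ⟨y, hy⟩ x) (isClosed_eq (by fun_prop) (by fun_prop)) y

/-- Variational principle: the ground state of `A` serves as trial vector for `B`. -/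
theorem energy_le_add (hk : ∀ x : D, B x = A x + k x) (hA : IsGroundResolvent A γ e ψ G)
    (hB : IsGroundResolvent B γ f χ F) : f ≤ e + ‖k‖ := by
  have h := hB.energy_le ⟨ψ, hA.ground_mem⟩
  rw [hk, hA.eigen, inner_add_right, inner_smul_right, inner_self_eq_norm_sq_to_K,
    hA.norm_ground] at h
  have h2 : (inner ℂ ψ (k ψ)).re ≤ ‖k‖ := by
    refine (Complex.re_le_norm _).trans ((norm_inner_le_norm _ _).trans ?_)
    have := k.le_opNorm ψ
    rwa [hA.norm_ground, mul_one, ← one_mul ‖k ψ‖, ← hA.norm_ground] at this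
  simp only [Complex.add_re] at h
  norm_num at h
  linarith

theorem abs_energy_sub_le (hk : ∀ x : D, B x = A x + k x) (hA : IsGroundResolvent A γ e ψ G)
    (hB : IsGroundResolvent B γ f χ F) : |f - e| ≤ ‖k‖ := by
  have h1 := energy_le_add hk hA hB
  have h2 := energy_le_add (k := -k) (fun x => by simp [hk]) hB hA
  rw [norm_neg] at h2
  exact abs_le.2 ⟨by linarith, by linarith⟩

/-- On the range of `stateProj χ` the operator `A` acts as `f - k`; apply `G (A - e + γP) = 1` there
and use `γ G P = P`. -/
theorem stateProj_sub_mul (hk : ∀ x : D, B x = A x + k x) (hA : IsGroundResolvent A γ e ψ G)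
    (hB : IsGroundResolvent B γ f χ F) :
    stateProj χ - stateProj ψ * stateProj χ = G * ((f - e) • 1 - k) * stateProj χ := by
  ext x
  have h := hA.left_inv ⟨_, hB.stateProj_mem x⟩
  have h1 : A ⟨_, hB.stateProj_mem x⟩ = (f : ℂ) • stateProj χ x - k (stateProj χ x) := by
    rw [← hB.map_stateProj, hk, add_sub_cancel_right]
  have h3 : (γ : ℂ) • G (stateProj ψ (stateProj χ x)) = stateProj ψ (stateProj χ x) := by
    have h := hA.left_inv ⟨_, hA.stateProj_mem (stateProj χ x)⟩
    have h2 : ∀ x, stateProj ψ (stateProj ψ x) = stateProj ψ x :=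
      DFunLike.congr_fun (stateProj_mul_self ψ)
    rwa [hA.map_stateProj, sub_self, zero_add, h2, map_smul] at h
  rw [h1, map_add, map_smul, h3] at h
  change stateProj χ x - stateProj ψ (stateProj χ x) =
    G ((f - e) • stateProj χ x - k (stateProj χ x))
  rw [sub_eq_iff_eq_add]
  refine h.symm.trans ?_
  congr 2
  simp only [Complex.coe_smul, sub_smul]
  abel

/-- The mixed product `stateProj ψ * stateProj χ` cancels between `stateProj_sub_mul` and the
adjoint of its version with the two operators exchanged. -/
theorem stateProj_sub (hk : ∀ x : D, B x = A x + k x) (hks : IsSelfAdjoint k)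
    (hA : IsGroundResolvent A γ e ψ G) (hB : IsGroundResolvent B γ f χ F) :
    stateProj χ - stateProj ψ =
      G * ((f - e) • 1 - k) * stateProj χ + stateProj ψ * ((f - e) • 1 - k) * F := by
  have h1 := stateProj_sub_mul hk hA hB
  have h2 := congrArg star (stateProj_sub_mul (k := -k) (fun x => by simp [hk]) hB hA)
  simp only [star_mul, star_sub, star_neg, star_smul, star_one, star_trivial,
    (isSelfAdjoint_stateProj ψ).star_eq, (isSelfAdjoint_stateProj χ).star_eq,
    hB.selfAdjoint.star_eq, hks.star_eq] at h2
  have h3 : (e - f) • (1 : E →L[ℂ] E) - -k = -((f - e) • 1 - k) := by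
    rw [← neg_sub f e, neg_smul]; abel
  rw [h3, neg_mul, mul_neg, ← mul_assoc] at h2
  rw [← h1, ← neg_eq_iff_eq_neg.2 h2]
  abel

/-- Second resolvent identity: the middle factor is the difference of the two inverted operators, in
which the unbounded parts cancel. -/
theorem resolvent_sub (hk : ∀ x : D, B x = A x + k x)
    (hA : IsGroundResolvent A γ e ψ G) (hB : IsGroundResolvent B γ f χ F) :
    F - G = -F * (k - (f - e) • 1 + γ • (stateProj χ - stateProj ψ)) * G := by
  ext x
  have h := hB.left_inv ⟨_, hA.mem x⟩
  rw [hk, hA.right_inv] at h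
  have h1 : x + (e : ℂ) • G x - (γ : ℂ) • stateProj ψ (G x) + k (G x) - (f : ℂ) • G x +
      (γ : ℂ) • stateProj χ (G x) =
      x + (k (G x) - (f - e) • G x + γ • (stateProj χ (G x) - stateProj ψ (G x))) := by
    simp only [Complex.coe_smul, sub_smul, smul_sub]
    abel
  rw [h1, map_add] at h
  change F x - G x =
    -F (k (G x) - (f - e) • G x + γ • (stateProj χ (G x) - stateProj ψ (G x)))
  rw [← eq_sub_iff_add_eq'] at h
  rw [h, neg_sub]

/-- A finite-difference Hellmann–Feynman formula. Using `stateProj χ ψ` in place of `χ` avoids any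
choice of phase for the ground states. -/
theorem energy_sub_mul (hk : ∀ x : D, B x = A x + k x)
    (hA : IsGroundResolvent A γ e ψ G) (hB : IsGroundResolvent B γ f χ F) :
    (f - e) * (inner ℂ ψ (stateProj χ ψ)).re = (inner ℂ ψ (k (stateProj χ ψ))).re := by
  have h := hA.inner_ground_map ⟨_, hB.stateProj_mem ψ⟩
  have h1 : A ⟨_, hB.stateProj_mem ψ⟩ = (f : ℂ) • stateProj χ ψ - k (stateProj χ ψ) := by
    rw [← hB.map_stateProj, hk, add_sub_cancel_right]
  rw [h1, inner_sub_right, inner_smul_right] at h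
  have := congrArg Complex.re h
  simp only [Complex.sub_re, Complex.re_ofReal_mul] at this
  linarith

theorem norm_shift_le (hk : ∀ x : D, B x = A x + k x)
    (hA : IsGroundResolvent A γ e ψ G) (hB : IsGroundResolvent B γ f χ F) :
    ‖(f - e) • (1 : E →L[ℂ] E) - k‖ ≤ 2 * ‖k‖ := by
  have h1 : ‖(f - e) • (1 : E →L[ℂ] E)‖ ≤ ‖k‖ := by
    rw [norm_smul, Real.norm_eq_abs]
    have h0 := abs_energy_sub_le hk hA hB
    have h1 : ‖(1 : E →L[ℂ] E)‖ ≤ 1 := ContinuousLinearMap.norm_id_le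
    nlinarith [abs_nonneg (f - e), norm_nonneg k]
  linarith [norm_sub_le ((f - e) • (1 : E →L[ℂ] E)) k]

end IsGroundResolvent

theorem norm_mul_mul_le_of_le {a b c : E →L[ℂ] E} {x y z : ℝ} (ha : ‖a‖ ≤ x) (hb : ‖b‖ ≤ y)
    (hc : ‖c‖ ≤ z) : ‖a * b * c‖ ≤ x * y * z :=
  (norm_mul_le _ _).trans <| mul_le_mul
    ((norm_mul_le _ _).trans (mul_le_mul ha hb (norm_nonneg _) ((norm_nonneg _).trans ha))) hc
    (norm_nonneg _) (mul_nonneg ((norm_nonneg _).trans ha) ((norm_nonneg _).trans hb))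

namespace IsGroundResolvent

variable [CompleteSpace E] {D : Submodule ℂ E} {A B : D →ₗ[ℂ] E} {k : E →L[ℂ] E}
  {γ e f : ℝ} {ψ χ : E} {G F : E →L[ℂ] E}

theorem norm_stateProj_sub_le (hk : ∀ x : D, B x = A x + k x) (hks : IsSelfAdjoint k)
    (hA : IsGroundResolvent A γ e ψ G) (hB : IsGroundResolvent B γ f χ F) :
    ‖stateProj χ - stateProj ψ‖ ≤ 4 * γ⁻¹ * ‖k‖ := by
  rw [stateProj_sub hk hks hA hB]
  refine (norm_add_le _ _).trans ?_
  have h1 := norm_mul_mul_le_of_le hA.norm_le (norm_shift_le hk hA hB) (norm_stateProj_le χ)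
  have h2 := norm_mul_mul_le_of_le (norm_stateProj_le ψ) (norm_shift_le hk hA hB) hB.norm_le
  linarith

theorem norm_resolvent_sub_le (hγ : 0 < γ) (hk : ∀ x : D, B x = A x + k x)
    (hks : IsSelfAdjoint k)
    (hA : IsGroundResolvent A γ e ψ G) (hB : IsGroundResolvent B γ f χ F) :
    ‖F - G‖ ≤ 6 * γ⁻¹ ^ 2 * ‖k‖ := by
  rw [resolvent_sub hk hA hB]
  have h1 := norm_shift_le hk hA hB
  rw [norm_sub_rev] at h1
  have h2 : ‖γ • (stateProj χ - stateProj ψ)‖ ≤ 4 * ‖k‖ := by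
    rw [norm_smul, Real.norm_of_nonneg hγ.le]
    calc γ * ‖stateProj χ - stateProj ψ‖ ≤ γ * (4 * γ⁻¹ * ‖k‖) :=
          mul_le_mul_of_nonneg_left (norm_stateProj_sub_le hk hks hA hB) hγ.le
      _ = 4 * ‖k‖ := by field_simp
  have h3 := norm_mul_mul_le_of_le (a := -F) ((norm_neg F).trans_le hB.norm_le)
    ((norm_add_le _ _).trans (add_le_add h1 h2)) hA.norm_le
  linarith

end IsGroundResolvent

/-! ### Derivatives and continuity from difference identities. -/

section Calculus

/-- Only `m` has to be differentiable; continuity of the outer factors suffices. This is why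
Lipschitz bounds for `P` and `G` come before their derivatives. -/
theorem hasDerivWithinAt_of_sub_eq_mul {𝒜 : Type*} [NormedRing 𝒜] [NormedAlgebra ℝ 𝒜]
    {f L m M : ℝ → 𝒜} {m' : 𝒜} {J : Set ℝ} {s : ℝ} (hL : ContinuousWithinAt L J s)
    (hM : ContinuousWithinAt M J s) (hm : HasDerivWithinAt m m' J s)
    (h : ∀ r ∈ J, f r - f s = L r * (m r - m s) * M r) :
    HasDerivWithinAt f (L s * m' * M s) J s := by
  rw [hasDerivWithinAt_iff_tendsto_slope] at hm ⊢
  have hsub : 𝓝[J \ {s}] s ≤ 𝓝[J] s := nhdsWithin_mono _ sdiff_subset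
  refine (((hL.mono_left hsub).mul hm).mul (hM.mono_left hsub)).congr' ?_
  filter_upwards [self_mem_nhdsWithin] with r hr
  rw [slope_def_module, slope_def_module, h r hr.1, mul_smul_comm, smul_mul_assoc]

theorem continuousWithinAt_of_norm_sub_le {V W : Type*} [NormedAddCommGroup V]
    [NormedAddCommGroup W] {f : ℝ → V} {m : ℝ → W} {J : Set ℝ} {s C : ℝ}
    (hm : ContinuousWithinAt m J s) (h : ∀ r ∈ J, ‖f r - f s‖ ≤ C * ‖m r - m s‖) :
    ContinuousWithinAt f J s := by
  have h1 : Tendsto (fun r => C * ‖m r - m s‖) (𝓝[J] s) (𝓝 0) := by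
    simpa using ((Filter.Tendsto.sub_const hm (m s)).norm).const_mul C
  refine tendsto_iff_norm_sub_tendsto_zero.2 (squeeze_zero' (Eventually.of_forall fun r =>
    norm_nonneg _) ?_ h1)
  filter_upwards [self_mem_nhdsWithin] with r hr using h r hr

end Calculus

end Adiabatic

/-! ### Derivatives of the ground energy, projection and resolvent along a gapped family. -/

namespace Adiabatic

variable {E : Type*} [NormedAddCommGroup E] [InnerProductSpace ℂ E]

/-- A twice differentiable family of symmetric operators on a common domain, with ground states
separated from the rest of the spectrum by at least `γ`; `K s` is the bounded operator
`A s - A 0`, up to a constant. -/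
structure IsGappedFamily [CompleteSpace E] {D : Submodule ℂ E} (A : ℝ → D →ₗ[ℂ] E)
    (γ b₁ b₂ : ℝ) (K K' K'' : ℝ → E →L[ℂ] E) (e : ℝ → ℝ) (ψ : ℝ → E) (G : ℝ → E →L[ℂ] E) :
    Prop where
  gap_pos : 0 < γ
  dense : Dense (D : Set E)
  ground : ∀ s ∈ Icc (0 : ℝ) 1, IsGroundResolvent (A s) γ (e s) (ψ s) (G s)
  map_eq : ∀ s ∈ Icc (0 : ℝ) 1, ∀ r ∈ Icc (0 : ℝ) 1, ∀ x : D, A r x = A s x + (K r - K s) x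
  hasDeriv : ∀ s ∈ Icc (0 : ℝ) 1, HasDerivWithinAt K (K' s) (Icc 0 1) s
  hasDeriv₂ : ∀ s ∈ Icc (0 : ℝ) 1, HasDerivWithinAt K' (K'' s) (Icc 0 1) s
  norm_deriv_le : ∀ s ∈ Icc (0 : ℝ) 1, ‖K' s‖ ≤ b₁
  norm_deriv₂_le : ∀ s ∈ Icc (0 : ℝ) 1, ‖K'' s‖ ≤ b₂

/-- The derivative of the ground energy. -/
noncomputable def energyDeriv (ψ : E) (K' : E →L[ℂ] E) : ℝ := (inner ℂ ψ (K' ψ)).re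

/-- The derivative of the ground state projection. -/
noncomputable def projDeriv (ψ : E) (G K' : E →L[ℂ] E) : E →L[ℂ] E :=
  G * (energyDeriv ψ K' • 1 - K') * stateProj ψ + stateProj ψ * (energyDeriv ψ K' • 1 - K') * G

/-- The derivative of the resolvent `(A - e + γ |ψ⟩⟨ψ|)⁻¹`. -/
noncomputable def resolventDeriv (γ : ℝ) (ψ : E) (G K' : E →L[ℂ] E) : E →L[ℂ] E :=
  -G * (K' - energyDeriv ψ K' • 1 + γ • projDeriv ψ G K') * G

/-- The reduced resolvent: the inverse of `A - e` on the orthogonal complement of `ψ`. -/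
noncomputable def reducedResolvent (γ : ℝ) (ψ : E) (G : E →L[ℂ] E) : E →L[ℂ] E :=
  G - γ⁻¹ • stateProj ψ

/-- The derivative of the reduced resolvent. -/
noncomputable def reducedResolventDeriv (γ : ℝ) (ψ : E) (G K' : E →L[ℂ] E) : E →L[ℂ] E :=
  resolventDeriv γ ψ G K' - γ⁻¹ • projDeriv ψ G K'

namespace IsGappedFamily

variable [CompleteSpace E] {D : Submodule ℂ E} {A : ℝ → D →ₗ[ℂ] E}
    {γ b₁ b₂ : ℝ} {K K' K'' : ℝ → E →L[ℂ] E} {e : ℝ → ℝ} {ψ : ℝ → E} {G : ℝ → E →L[ℂ] E}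
    (h : IsGappedFamily A γ b₁ b₂ K K' K'' e ψ G) {s r : ℝ}
include h

theorem isSelfAdjoint_sub (hs : s ∈ Icc (0 : ℝ) 1) (hr : r ∈ Icc (0 : ℝ) 1) :
    IsSelfAdjoint (K r - K s) :=
  IsGroundResolvent.isSelfAdjoint_perturbation (h.map_eq s hs r hr) h.dense (h.ground s hs)
    (h.ground r hr)

theorem isSelfAdjoint_deriv (hs : s ∈ Icc (0 : ℝ) 1) : IsSelfAdjoint (K' s) := by
  have h1 := (h.hasDeriv s hs).sub_const (K s)
  have h2 : HasDerivWithinAt (fun r => K r - K s) (star (K' s)) (Icc 0 1) s :=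
    h1.star.congr (fun r hr => ((h.isSelfAdjoint_sub hs hr).star_eq).symm)
      ((h.isSelfAdjoint_sub hs hs).star_eq).symm
  exact (uniqueDiffOn_Icc_zero_one s hs).eq_deriv _ h2 h1

theorem continuousWithinAt_stateProj (hs : s ∈ Icc (0 : ℝ) 1) :
    ContinuousWithinAt (fun r => stateProj (ψ r)) (Icc 0 1) s :=
  continuousWithinAt_of_norm_sub_le (h.hasDeriv s hs).continuousWithinAt fun r hr =>
    IsGroundResolvent.norm_stateProj_sub_le (h.map_eq s hs r hr) (h.isSelfAdjoint_sub hs hr)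
      (h.ground s hs) (h.ground r hr)

theorem continuousWithinAt_resolvent (hs : s ∈ Icc (0 : ℝ) 1) :
    ContinuousWithinAt G (Icc 0 1) s :=
  continuousWithinAt_of_norm_sub_le (h.hasDeriv s hs).continuousWithinAt fun r hr =>
    IsGroundResolvent.norm_resolvent_sub_le h.gap_pos (h.map_eq s hs r hr)
      (h.isSelfAdjoint_sub hs hr) (h.ground s hs) (h.ground r hr)

/-- Divide `energy_sub_mul` by `r - s` and by the overlap `⟨ψ s, P(r) ψ s⟩`, which tends to `1` by
continuity of the projection. -/
theorem hasDerivWithinAt_energy (hs : s ∈ Icc (0 : ℝ) 1) :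
    HasDerivWithinAt e (energyDeriv (ψ s) (K' s)) (Icc 0 1) s := by
  have hsub : 𝓝[Icc (0 : ℝ) 1 \ {s}] s ≤ 𝓝[Icc (0 : ℝ) 1] s := nhdsWithin_mono _ sdiff_subset
  have hP := (h.continuousWithinAt_stateProj hs).mono_left hsub
  have hK := hasDerivWithinAt_iff_tendsto_slope.1 (h.hasDeriv s hs)
  have hPψ : Tendsto (fun r => stateProj (ψ r) (ψ s)) (𝓝[Icc (0 : ℝ) 1 \ {s}] s) (𝓝 (ψ s)) := by
    have := ((ContinuousLinearMap.apply ℂ E (ψ s)).continuous.tendsto _).comp hP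
    simpa [Function.comp_def, stateProj_self] using this
  have hc : Tendsto (fun r => (inner ℂ (ψ s) (stateProj (ψ r) (ψ s))).re)
      (𝓝[Icc (0 : ℝ) 1 \ {s}] s) (𝓝 1) := by
    have := (Complex.continuous_re.tendsto _).comp
      ((tendsto_const_nhds (x := ψ s)).inner (𝕜 := ℂ) hPψ)
    rw [inner_self_eq_norm_sq_to_K, (h.ground s hs).norm_ground] at this
    simpa [Function.comp_def] using this
  have hn : Tendsto (fun r => (inner ℂ (ψ s) (slope K s r (stateProj (ψ r) (ψ s)))).re)
      (𝓝[Icc (0 : ℝ) 1 \ {s}] s) (𝓝 (energyDeriv (ψ s) (K' s))) :=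
    (Complex.continuous_re.tendsto _).comp
      ((tendsto_const_nhds (x := ψ s)).inner (𝕜 := ℂ)
        ((isBoundedBilinearMap_apply (𝕜 := ℂ)).continuous.tendsto (K' s, ψ s) |>.comp
          (hK.prodMk_nhds hPψ)))
  rw [hasDerivWithinAt_iff_tendsto_slope]
  have hq := hn.div hc one_ne_zero
  rw [div_one] at hq
  refine hq.congr' ?_
  filter_upwards [self_mem_nhdsWithin, hc.eventually_ne one_ne_zero] with r hr hr0
  have h1 := IsGroundResolvent.energy_sub_mul (h.map_eq s hs r hr.1) (h.ground s hs)
    (h.ground r hr.1)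
  rw [Pi.div_apply, div_eq_iff hr0, slope_def_module, slope_def_module, smul_eq_mul, mul_assoc, h1,
    smul_apply, ← Complex.coe_smul, inner_smul_right, Complex.re_ofReal_mul]

theorem hasDerivWithinAt_shift (hs : s ∈ Icc (0 : ℝ) 1) :
    HasDerivWithinAt (fun r => e r • (1 : E →L[ℂ] E) - K r)
      (energyDeriv (ψ s) (K' s) • 1 - K' s) (Icc 0 1) s :=
  ((h.hasDerivWithinAt_energy hs).smul_const 1).sub (h.hasDeriv s hs)

theorem hasDerivWithinAt_stateProj (hs : s ∈ Icc (0 : ℝ) 1) :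
    HasDerivWithinAt (fun r => stateProj (ψ r)) (projDeriv (ψ s) (G s) (K' s)) (Icc 0 1) s := by
  have hm := h.hasDerivWithinAt_shift hs
  have h1 := hasDerivWithinAt_of_sub_eq_mul
    (f := fun r => G s * ((e r • (1 : E →L[ℂ] E) - K r) - (e s • 1 - K s)) * stateProj (ψ r))
    (L := fun _ => G s) continuousWithinAt_const (h.continuousWithinAt_stateProj hs) hm
    (fun r _ => by simp)
  have h2 := hasDerivWithinAt_of_sub_eq_mul
    (f := fun r => stateProj (ψ s) * ((e r • (1 : E →L[ℂ] E) - K r) - (e s • 1 - K s)) * G r)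
    (L := fun _ => stateProj (ψ s)) continuousWithinAt_const
    (h.continuousWithinAt_resolvent hs) hm (fun r _ => by simp)
  have key : ∀ r ∈ Icc (0 : ℝ) 1, stateProj (ψ r) =
      G s * ((e r • (1 : E →L[ℂ] E) - K r) - (e s • 1 - K s)) * stateProj (ψ r) +
      stateProj (ψ s) * ((e r • (1 : E →L[ℂ] E) - K r) - (e s • 1 - K s)) * G r +
      stateProj (ψ s) := fun r hr => by
    have := IsGroundResolvent.stateProj_sub (h.map_eq s hs r hr) (h.isSelfAdjoint_sub hs hr)
      (h.ground s hs) (h.ground r hr)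
    rw [← sub_eq_iff_eq_add, this, sub_smul, sub_sub_sub_comm]
  exact ((h1.add h2).add_const (stateProj (ψ s))).congr key (key s hs)

theorem hasDerivWithinAt_resolvent (hs : s ∈ Icc (0 : ℝ) 1) :
    HasDerivWithinAt G (resolventDeriv γ (ψ s) (G s) (K' s)) (Icc 0 1) s := by
  refine hasDerivWithinAt_of_sub_eq_mul (L := fun r => -G r) (M := fun _ => G s)
    (m := fun r => K r - e r • (1 : E →L[ℂ] E) + γ • stateProj (ψ r))
    (h.continuousWithinAt_resolvent hs).neg continuousWithinAt_const
    (((h.hasDeriv s hs).sub ((h.hasDerivWithinAt_energy hs).smul_const 1)).add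
      ((h.hasDerivWithinAt_stateProj hs).const_smul γ)) fun r hr => ?_
  rw [IsGroundResolvent.resolvent_sub (h.map_eq s hs r hr) (h.ground s hs) (h.ground r hr)]
  congr 2
  rw [sub_smul, smul_sub]
  abel

theorem hasDerivWithinAt_reducedResolvent (hs : s ∈ Icc (0 : ℝ) 1) :
    HasDerivWithinAt (fun r => reducedResolvent γ (ψ r) (G r))
      (reducedResolventDeriv γ (ψ s) (G s) (K' s)) (Icc 0 1) s :=
  (h.hasDerivWithinAt_resolvent hs).sub ((h.hasDerivWithinAt_stateProj hs).const_smul γ⁻¹)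

theorem norm_shift_deriv_le (hs : s ∈ Icc (0 : ℝ) 1) :
    ‖energyDeriv (ψ s) (K' s) • (1 : E →L[ℂ] E) - K' s‖ ≤ 2 * b₁ := by
  have h1 : |energyDeriv (ψ s) (K' s)| ≤ ‖K' s‖ := by
    refine (Complex.abs_re_le_norm _).trans ((norm_inner_le_norm _ _).trans ?_)
    have := (K' s).le_opNorm (ψ s)
    rw [(h.ground s hs).norm_ground] at this ⊢
    linarith
  have h2 : ‖(1 : E →L[ℂ] E)‖ ≤ 1 := ContinuousLinearMap.norm_id_le
  have h3 : ‖energyDeriv (ψ s) (K' s) • (1 : E →L[ℂ] E)‖ ≤ ‖K' s‖ := by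
    rw [norm_smul, Real.norm_eq_abs]
    exact (mul_le_of_le_one_right (abs_nonneg _) h2).trans h1
  linarith [norm_sub_le (energyDeriv (ψ s) (K' s) • (1 : E →L[ℂ] E)) (K' s),
    h.norm_deriv_le s hs]

theorem norm_projDeriv_le (hs : s ∈ Icc (0 : ℝ) 1) :
    ‖projDeriv (ψ s) (G s) (K' s)‖ ≤ 4 * γ⁻¹ * b₁ := by
  have hg := (h.ground s hs).norm_le
  have h1 := norm_mul_mul_le_of_le hg (h.norm_shift_deriv_le hs) (norm_stateProj_le (ψ s))
  have h2 := norm_mul_mul_le_of_le (norm_stateProj_le (ψ s)) (h.norm_shift_deriv_le hs) hg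
  refine (norm_add_le _ _).trans ?_
  linarith

theorem norm_reducedResolventDeriv_le (hs : s ∈ Icc (0 : ℝ) 1) :
    ‖reducedResolventDeriv γ (ψ s) (G s) (K' s)‖ ≤ 10 * γ⁻¹ ^ 2 * b₁ := by
  have hγ := h.gap_pos
  have hg := (h.ground s hs).norm_le
  have hp := h.norm_projDeriv_le hs
  have h1 := h.norm_shift_deriv_le hs
  rw [norm_sub_rev] at h1
  have h2 : ‖γ • projDeriv (ψ s) (G s) (K' s)‖ ≤ 4 * b₁ := by
    rw [norm_smul, Real.norm_of_nonneg hγ.le]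
    calc γ * ‖projDeriv (ψ s) (G s) (K' s)‖ ≤ γ * (4 * γ⁻¹ * b₁) :=
          mul_le_mul_of_nonneg_left hp hγ.le
      _ = 4 * b₁ := by field_simp
  have h3 : ‖γ⁻¹ • projDeriv (ψ s) (G s) (K' s)‖ ≤ γ⁻¹ * (4 * γ⁻¹ * b₁) := by
    rw [norm_smul, Real.norm_of_nonneg (inv_nonneg.2 hγ.le)]
    exact mul_le_mul_of_nonneg_left hp (inv_nonneg.2 hγ.le)
  have h4 := norm_mul_mul_le_of_le (a := -G s) ((norm_neg (G s)).trans_le hg)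
    ((norm_add_le _ _).trans (add_le_add h1 h2)) hg
  refine (norm_sub_le _ _).trans ((add_le_add h4 h3).trans_eq ?_)
  ring

end IsGappedFamily

end Adiabatic

/-! ### The reduced resolvent `S` and the correction operator `X = P A' S²`. -/

namespace Adiabatic

variable {E : Type*} [NormedAddCommGroup E] [InnerProductSpace ℂ E]

theorem norm_one_sub_stateProj_le (ψ : E) : ‖(1 : E →L[ℂ] E) - stateProj ψ‖ ≤ 1 := by
  have : (1 : E →L[ℂ] E) - stateProj ψ = (Submodule.span ℂ {ψ})ᗮ.starProjection := by
    rw [Submodule.starProjection_orthogonal]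
    rfl
  rw [this]
  exact Submodule.starProjection_norm_le _

namespace IsGroundResolvent

variable [CompleteSpace E] {D : Submodule ℂ E} {A : D →ₗ[ℂ] E} {γ e : ℝ} {ψ : E} {G : E →L[ℂ] E}

theorem reducedResolvent_mul_stateProj (hA : IsGroundResolvent A γ e ψ G) (hγ : 0 < γ) :
    reducedResolvent γ ψ G * stateProj ψ = 0 := by
  rw [reducedResolvent, sub_mul, hA.resolvent_mul_stateProj hγ, smul_mul_assoc, stateProj_mul_self,
    sub_self]

theorem stateProj_mul_reducedResolvent (hA : IsGroundResolvent A γ e ψ G) (hγ : 0 < γ) :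
    stateProj ψ * reducedResolvent γ ψ G = 0 := by
  rw [reducedResolvent, mul_sub, hA.stateProj_mul_resolvent hγ, mul_smul_comm, stateProj_mul_self,
    sub_self]

theorem isSelfAdjoint_reducedResolvent (hA : IsGroundResolvent A γ e ψ G) :
    IsSelfAdjoint (reducedResolvent γ ψ G) :=
  hA.selfAdjoint.sub ((IsSelfAdjoint.all γ⁻¹).smul (isSelfAdjoint_stateProj ψ))

theorem norm_reducedResolvent_le (hA : IsGroundResolvent A γ e ψ G) (hγ : 0 < γ) :
    ‖reducedResolvent γ ψ G‖ ≤ γ⁻¹ := by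
  have : reducedResolvent γ ψ G = G * (1 - stateProj ψ) := by
    rw [mul_sub, mul_one, hA.resolvent_mul_stateProj hγ, reducedResolvent]
  rw [this]
  refine (norm_mul_le _ _).trans ?_
  exact (mul_le_of_le_one_right (norm_nonneg _) (norm_one_sub_stateProj_le ψ)).trans hA.norm_le

theorem reducedResolvent_map (hA : IsGroundResolvent A γ e ψ G) (hγ : 0 < γ) (x : D) :
    reducedResolvent γ ψ G (A x) =
      (x : E) - stateProj ψ (x : E) + (e : ℂ) • reducedResolvent γ ψ G (x : E) := by
  have h := hA.left_inv x
  have h1 : G (stateProj ψ (x : E)) = γ⁻¹ • stateProj ψ (x : E) :=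
    DFunLike.congr_fun (hA.resolvent_mul_stateProj hγ) (x : E)
  rw [map_add, map_sub, map_smul, map_smul, h1, Complex.coe_smul γ, smul_inv_smul₀ hγ.ne'] at h
  change G (A x) - γ⁻¹ • stateProj ψ (A x) =
    (x : E) - stateProj ψ (x : E) + (e : ℂ) • (G (x : E) - γ⁻¹ • stateProj ψ (x : E))
  rw [hA.stateProj_map, smul_sub, smul_comm γ⁻¹ (e : ℂ)]
  rw [← eq_sub_iff_add_eq, sub_eq_iff_eq_add] at h
  rw [h]
  abel

end IsGroundResolvent

namespace IsGappedFamily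

variable [CompleteSpace E] {D : Submodule ℂ E} {A : ℝ → D →ₗ[ℂ] E}
    {γ b₁ b₂ : ℝ} {K K' K'' : ℝ → E →L[ℂ] E} {e : ℝ → ℝ} {ψ : ℝ → E} {G : ℝ → E →L[ℂ] E}
    (h : IsGappedFamily A γ b₁ b₂ K K' K'' e ψ G) {s r : ℝ}
include h

theorem stateProj_mul_shift_mul_stateProj (hs : s ∈ Icc (0 : ℝ) 1) :
    stateProj (ψ s) * (energyDeriv (ψ s) (K' s) • 1 - K' s) * stateProj (ψ s) = 0 := by
  ext x
  have h1 := (h.ground s hs).norm_ground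
  have h2 : ((energyDeriv (ψ s) (K' s) : ℝ) : ℂ) = inner ℂ (ψ s) (K' s (ψ s)) := by
    have h3 := (ContinuousLinearMap.isSelfAdjoint_iff_isSymmetric.1
      (h.isSelfAdjoint_deriv hs)) (ψ s) (ψ s)
    refine Complex.conj_eq_iff_re.1 ?_
    rw [inner_conj_symm]
    exact h3
  change stateProj (ψ s) (energyDeriv (ψ s) (K' s) • stateProj (ψ s) x -
    K' s (stateProj (ψ s) x)) = 0
  rw [stateProj_apply h1 x, stateProj_apply h1, ← Complex.coe_smul, map_smul, inner_sub_right,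
    inner_smul_right, inner_smul_right, inner_smul_right, h2, inner_self_eq_norm_sq_to_K, h1]
  simp [mul_comm]

/-- Substitute `G = S + γ⁻¹ P`: the `P`-parts vanish by `stateProj_mul_shift_mul_stateProj`, and the
energy terms vanish because `S P = P S = 0`. -/
theorem projDeriv_eq (hs : s ∈ Icc (0 : ℝ) 1) :
    projDeriv (ψ s) (G s) (K' s) =
      -(reducedResolvent γ (ψ s) (G s) * K' s * stateProj (ψ s) +
        stateProj (ψ s) * K' s * reducedResolvent γ (ψ s) (G s)) := by
  have hg := h.ground s hs
  have h1 := h.stateProj_mul_shift_mul_stateProj hs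
  have hG : G s = reducedResolvent γ (ψ s) (G s) + γ⁻¹ • stateProj (ψ s) := by
    rw [reducedResolvent, sub_add_cancel]
  have h2 := hg.reducedResolvent_mul_stateProj h.gap_pos
  have h3 := hg.stateProj_mul_reducedResolvent h.gap_pos
  rw [projDeriv]
  generalize reducedResolvent γ (ψ s) (G s) = S at *
  rw [hG, add_mul, add_mul, mul_add, smul_mul_assoc, smul_mul_assoc, h1, mul_smul_comm, h1]
  simp only [mul_sub, sub_mul, mul_smul_comm, smul_mul_assoc, mul_one, h2, h3, smul_zero]
  abel

/-- Differentiating `S P = 0` gives `S' P = -S P'`, and `projDeriv_eq` evaluates the right-hand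
side. -/
theorem reducedResolventDeriv_mul_stateProj (hs : s ∈ Icc (0 : ℝ) 1) :
    reducedResolventDeriv γ (ψ s) (G s) (K' s) * stateProj (ψ s) =
      reducedResolvent γ (ψ s) (G s) * reducedResolvent γ (ψ s) (G s) * K' s *
        stateProj (ψ s) := by
  have hg := h.ground s hs
  have h1 := (h.hasDerivWithinAt_reducedResolvent hs).mul (h.hasDerivWithinAt_stateProj hs)
  have h2 : HasDerivWithinAt (fun r => reducedResolvent γ (ψ r) (G r) * stateProj (ψ r)) 0
      (Icc 0 1) s :=
    (hasDerivWithinAt_const s (Icc 0 1) (0 : E →L[ℂ] E)).congr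
      (fun r hr => (h.ground r hr).reducedResolvent_mul_stateProj h.gap_pos)
      (hg.reducedResolvent_mul_stateProj h.gap_pos)
  have h3 := (uniqueDiffOn_Icc_zero_one s hs).eq_deriv _ h1 h2
  rw [add_eq_zero_iff_eq_neg] at h3
  rw [h3, h.projDeriv_eq hs, mul_neg, neg_neg, mul_add, ← mul_assoc, ← mul_assoc,
    ← mul_assoc (reducedResolvent γ (ψ s) (G s)) (stateProj (ψ s) * K' s),
    ← mul_assoc (reducedResolvent γ (ψ s) (G s)) (stateProj (ψ s)),
    hg.reducedResolvent_mul_stateProj h.gap_pos, zero_mul, zero_mul, add_zero]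

end IsGappedFamily

/-- The operator `P A' S²` whose expectation value governs the leading adiabatic correction. -/
noncomputable def correction (γ : ℝ) (ψ : E) (G K' : E →L[ℂ] E) : E →L[ℂ] E :=
  stateProj ψ * K' * (reducedResolvent γ ψ G * reducedResolvent γ ψ G)

/-- The derivative of `correction`. -/
noncomputable def correctionDeriv (γ : ℝ) (ψ : E) (G K' K'' : E →L[ℂ] E) : E →L[ℂ] E :=
  (projDeriv ψ G K' * K' + stateProj ψ * K'') *
      (reducedResolvent γ ψ G * reducedResolvent γ ψ G) +
    stateProj ψ * K' * (reducedResolventDeriv γ ψ G K' * reducedResolvent γ ψ G +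
      reducedResolvent γ ψ G * reducedResolventDeriv γ ψ G K')

namespace IsGappedFamily

variable [CompleteSpace E] {D : Submodule ℂ E} {A : ℝ → D →ₗ[ℂ] E}
    {γ b₁ b₂ : ℝ} {K K' K'' : ℝ → E →L[ℂ] E} {e : ℝ → ℝ} {ψ : ℝ → E} {G : ℝ → E →L[ℂ] E}
    (h : IsGappedFamily A γ b₁ b₂ K K' K'' e ψ G) {s r : ℝ}
include h

theorem hasDerivWithinAt_correction (hs : s ∈ Icc (0 : ℝ) 1) :
    HasDerivWithinAt (fun r => correction γ (ψ r) (G r) (K' r))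
      (correctionDeriv γ (ψ s) (G s) (K' s) (K'' s)) (Icc 0 1) s :=
  ((h.hasDerivWithinAt_stateProj hs).mul (h.hasDeriv₂ s hs)).mul
    ((h.hasDerivWithinAt_reducedResolvent hs).mul (h.hasDerivWithinAt_reducedResolvent hs))

theorem correction_mul_stateProj (hs : s ∈ Icc (0 : ℝ) 1) :
    correction γ (ψ s) (G s) (K' s) * stateProj (ψ s) = 0 := by
  rw [correction, mul_assoc, mul_assoc (reducedResolvent γ (ψ s) (G s)),
    (h.ground s hs).reducedResolvent_mul_stateProj h.gap_pos, mul_zero, mul_zero]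

theorem norm_correction_le (hs : s ∈ Icc (0 : ℝ) 1) :
    ‖correction γ (ψ s) (G s) (K' s)‖ ≤ γ⁻¹ ^ 2 * b₁ := by
  have hS := (h.ground s hs).norm_reducedResolvent_le h.gap_pos
  have h1 : ‖reducedResolvent γ (ψ s) (G s) * reducedResolvent γ (ψ s) (G s)‖ ≤ γ⁻¹ * γ⁻¹ :=
    (norm_mul_le _ _).trans (mul_le_mul hS hS (norm_nonneg _) ((norm_nonneg _).trans hS))
  refine (norm_mul_mul_le_of_le (norm_stateProj_le _) (h.norm_deriv_le s hs) h1).trans_eq ?_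
  ring

theorem norm_correctionDeriv_le (hs : s ∈ Icc (0 : ℝ) 1) :
    ‖correctionDeriv γ (ψ s) (G s) (K' s) (K'' s)‖ ≤
      γ⁻¹ ^ 2 * b₂ + 24 * γ⁻¹ ^ 3 * b₁ ^ 2 := by
  have hS := (h.ground s hs).norm_reducedResolvent_le h.gap_pos
  have hS' := h.norm_reducedResolventDeriv_le hs
  have hP := norm_stateProj_le (ψ s)
  have hP' := h.norm_projDeriv_le hs
  have hK := h.norm_deriv_le s hs
  have hK' := h.norm_deriv₂_le s hs
  have mul_le : ∀ {a b : E →L[ℂ] E} {x y : ℝ}, ‖a‖ ≤ x → ‖b‖ ≤ y → ‖a * b‖ ≤ x * y :=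
    fun ha hb => (norm_mul_le _ _).trans (mul_le_mul ha hb (norm_nonneg _)
      ((norm_nonneg _).trans ha))
  have add_le : ∀ {a b : E →L[ℂ] E} {x y : ℝ}, ‖a‖ ≤ x → ‖b‖ ≤ y → ‖a + b‖ ≤ x + y :=
    fun ha hb => (norm_add_le _ _).trans (add_le_add ha hb)
  -- The constant `24` is `4 + 2 · 10`: one term with `P'` and two with `S'`.
  refine (add_le (mul_le (add_le (mul_le hP' hK) (mul_le hP hK')) (mul_le hS hS))
    (mul_le (mul_le hP hK) (add_le (mul_le hS' hS) (mul_le hS hS')))).trans_eq ?_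
  ring

/-- By `S P = 0` and the formula for `S' P`, the product `X' P` equals `T* S T` with `T = S A' P`,
so its expectation values are real. This cancellation improves the error from order `τ^(-1/2)` to
order `1/τ`. -/
theorem im_inner_correctionDeriv_stateProj (hs : s ∈ Icc (0 : ℝ) 1) (x : E) :
    (inner ℂ x (correctionDeriv γ (ψ s) (G s) (K' s) (K'' s) (stateProj (ψ s) x))).im = 0 := by
  have hg := h.ground s hs
  have hop : correctionDeriv γ (ψ s) (G s) (K' s) (K'' s) * stateProj (ψ s) =
      star (reducedResolvent γ (ψ s) (G s) * K' s * stateProj (ψ s)) *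
        reducedResolvent γ (ψ s) (G s) *
        (reducedResolvent γ (ψ s) (G s) * K' s * stateProj (ψ s)) := by
    have h1 := hg.reducedResolvent_mul_stateProj h.gap_pos
    have h2 := h.reducedResolventDeriv_mul_stateProj hs
    rw [star_mul, star_mul, (isSelfAdjoint_stateProj (ψ s)).star_eq,
      (h.isSelfAdjoint_deriv hs).star_eq, hg.isSelfAdjoint_reducedResolvent.star_eq,
      correctionDeriv]
    generalize reducedResolvent γ (ψ s) (G s) = S at *
    simp only [add_mul, mul_assoc] at h2 ⊢
    rw [h1, h2]
    simp only [mul_zero, add_zero, zero_add]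
  have hsa := hg.isSelfAdjoint_reducedResolvent
  generalize reducedResolvent γ (ψ s) (G s) = S at *
  change (inner ℂ x ((correctionDeriv γ (ψ s) (G s) (K' s) (K'' s) * stateProj (ψ s)) x)).im = 0
  rw [hop]
  generalize S * K' s * stateProj (ψ s) = T
  change (inner ℂ x (ContinuousLinearMap.adjoint T (S (T x)))).im = 0
  rw [ContinuousLinearMap.adjoint_inner_right]
  have h3 := (ContinuousLinearMap.isSelfAdjoint_iff_isSymmetric.1 hsa) (T x) (T x)
  refine Complex.conj_eq_iff_im.1 ?_
  rw [inner_conj_symm]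
  exact h3

theorem abs_im_inner_correctionDeriv_le (hs : s ∈ Icc (0 : ℝ) 1) {x : E} (hx : ‖x‖ = 1) :
    |(inner ℂ x (correctionDeriv γ (ψ s) (G s) (K' s) (K'' s) x)).im| ≤
      (γ⁻¹ ^ 2 * b₂ + 24 * γ⁻¹ ^ 3 * b₁ ^ 2) * ‖x - stateProj (ψ s) x‖ := by
  have h1 := h.im_inner_correctionDeriv_stateProj hs x
  have h2 : (inner ℂ x (correctionDeriv γ (ψ s) (G s) (K' s) (K'' s) x)).im =
      (inner ℂ x (correctionDeriv γ (ψ s) (G s) (K' s) (K'' s) (x - stateProj (ψ s) x))).im := by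
    rw [map_sub, inner_sub_right, Complex.sub_im, h1, sub_zero]
  rw [h2]
  refine (Complex.abs_im_le_norm _).trans ((norm_inner_le_norm _ _).trans ?_)
  rw [hx, one_mul]
  exact ContinuousLinearMap.le_of_opNorm_le _ (h.norm_correctionDeriv_le hs) _

theorem abs_im_inner_correction_le (hs : s ∈ Icc (0 : ℝ) 1) {x : E} (hx : ‖x‖ = 1) :
    |(inner ℂ x (correction γ (ψ s) (G s) (K' s) x)).im| ≤
      γ⁻¹ ^ 2 * b₁ * ‖x - stateProj (ψ s) x‖ := by
  have h1 : correction γ (ψ s) (G s) (K' s) (stateProj (ψ s) x) = 0 :=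
    DFunLike.congr_fun (h.correction_mul_stateProj hs) x
  have h2 : correction γ (ψ s) (G s) (K' s) x =
      correction γ (ψ s) (G s) (K' s) (x - stateProj (ψ s) x) := by
    rw [map_sub, h1, sub_zero]
  rw [h2]
  refine (Complex.abs_im_le_norm _).trans ((norm_inner_le_norm _ _).trans ?_)
  rw [hx, one_mul]
  exact ContinuousLinearMap.le_of_opNorm_le _ (h.norm_correction_le hs) _

end IsGappedFamily

end Adiabatic

/-! ### The adiabatic estimate for the evolved state. -/

namespace Adiabatic

variable {E : Type*} [NormedAddCommGroup E] [InnerProductSpace ℂ E]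

theorem norm_sub_stateProj_sq (φ x : E) :
    ‖x - stateProj φ x‖ ^ 2 = ‖x‖ ^ 2 - (inner ℂ x (stateProj φ x)).re := by
  have h1 : inner ℂ (stateProj φ x) (stateProj φ x) = inner ℂ x (stateProj φ x) := by
    have h : stateProj φ (stateProj φ x) = stateProj φ x :=
      DFunLike.congr_fun (stateProj_mul_self φ) x
    exact (Submodule.inner_starProjection_left_eq_right _ x _).trans (congrArg (inner ℂ x) h)
  have h2 : ‖stateProj φ x‖ ^ 2 = (inner ℂ x (stateProj φ x)).re := by
    rw [← h1, inner_self_eq_norm_sq_to_K]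
    norm_cast
  rw [norm_sub_sq (𝕜 := ℂ), h2]
  change _ - 2 * (inner ℂ x (stateProj φ x)).re + _ = _
  ring

theorem hasDerivWithinAt_clm_apply {T : ℝ → E →L[ℂ] E} {T' : E →L[ℂ] E} {u : ℝ → E} {u' : E}
    {J : Set ℝ} {s : ℝ} (hT : HasDerivWithinAt T T' J s) (hu : HasDerivWithinAt u u' J s) :
    HasDerivWithinAt (fun r => T r (u r)) (T' (u s) + T s u') J s :=
  ((ContinuousLinearMap.restrictScalarsL ℂ E E ℝ ℝ).hasFDerivAt.comp_hasDerivWithinAt s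
    hT).clm_apply hu

theorem hasDerivWithinAt_inner_clm {T : ℝ → E →L[ℂ] E} {T' : E →L[ℂ] E} {u : ℝ → E} {u' : E}
    {J : Set ℝ} {s : ℝ} (hT : HasDerivWithinAt T T' J s) (hu : HasDerivWithinAt u u' J s) :
    HasDerivWithinAt (fun r => inner ℂ (u r) (T r (u r)))
      (inner ℂ (u s) (T' (u s)) + inner ℂ (u s) (T s u') + inner ℂ u' (T s (u s))) J s := by
  have := hu.inner ℂ (hasDerivWithinAt_clm_apply hT hu)
  rwa [inner_add_right] at this

namespace IsGappedFamily

variable [CompleteSpace E] {D : Submodule ℂ E} {A : ℝ → D →ₗ[ℂ] E}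
    {γ b₁ b₂ : ℝ} {K K' K'' : ℝ → E →L[ℂ] E} {e : ℝ → ℝ} {ψ : ℝ → E} {G : ℝ → E →L[ℂ] E}
    (h : IsGappedFamily A γ b₁ b₂ K K' K'' e ψ G) {s r τ : ℝ} {u : ℝ → E}
include h

/-- The two terms with `τ` cancel because `A` commutes with `P`. The two halves of `P'` are adjoint
to each other up to the common sign, which gives the factor `-2`. -/
theorem hasDerivWithinAt_inner_stateProj (hs : s ∈ Icc (0 : ℝ) 1) (hus : u s ∈ D)
    (hu : HasDerivWithinAt u (-(Complex.I * (τ : ℂ)) • A s ⟨u s, hus⟩) (Icc 0 1) s) :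
    HasDerivWithinAt (fun r => (inner ℂ (u r) (stateProj (ψ r) (u r))).re)
      (-2 * (inner ℂ (u s) (stateProj (ψ s) (K' s (reducedResolvent γ (ψ s) (G s) (u s))))).re)
      (Icc 0 1) s := by
  have hg := h.ground s hs
  have h1 := hasDerivWithinAt_inner_clm (h.hasDerivWithinAt_stateProj hs) hu
  refine (Complex.reCLM.hasFDerivAt.comp_hasDerivWithinAt s h1).congr_deriv ?_
  rw [Complex.reCLM_apply, map_smul, hg.stateProj_map, inner_smul_left,
    hg.symm ⟨u s, hus⟩ ⟨_, hg.stateProj_mem (u s)⟩, hg.map_stateProj, inner_smul_right,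
    inner_smul_right, h.projDeriv_eq hs]
  have h2 : inner ℂ (u s) (-(reducedResolvent γ (ψ s) (G s) * K' s * stateProj (ψ s) +
        stateProj (ψ s) * K' s * reducedResolvent γ (ψ s) (G s)) (u s)) =
      -(inner ℂ (u s) (reducedResolvent γ (ψ s) (G s) (K' s (stateProj (ψ s) (u s)))) +
        inner ℂ (u s) (stateProj (ψ s) (K' s (reducedResolvent γ (ψ s) (G s) (u s))))) := by
    rw [← inner_add_right, ← inner_neg_right]
    rfl
  have h3 : inner ℂ (u s) (reducedResolvent γ (ψ s) (G s) (K' s (stateProj (ψ s) (u s)))) =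
      inner ℂ (stateProj (ψ s) (K' s (reducedResolvent γ (ψ s) (G s) (u s)))) (u s) := by
    have a1 := ContinuousLinearMap.isSelfAdjoint_iff_isSymmetric.1
      hg.isSelfAdjoint_reducedResolvent
    have a2 := ContinuousLinearMap.isSelfAdjoint_iff_isSymmetric.1 (h.isSelfAdjoint_deriv hs)
    have a3 := ContinuousLinearMap.isSelfAdjoint_iff_isSymmetric.1 (isSelfAdjoint_stateProj (ψ s))
    exact ((a1 _ _).symm.trans (a2 _ _).symm).trans (a3 _ _).symm
  rw [← inner_conj_symm (stateProj (ψ s) _)] at h3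
  simp only [neg_apply, inner_neg_right] at h2 ⊢
  rw [h2, h3]
  simp only [map_neg, map_mul, Complex.conj_I, Complex.conj_ofReal, Complex.add_re,
    Complex.neg_re, Complex.conj_re]
  simp only [Complex.mul_re, Complex.mul_im, Complex.neg_re, Complex.neg_im, Complex.I_re,
    Complex.I_im, Complex.ofReal_re, Complex.ofReal_im]
  ring

/-- The Schrödinger terms produce the commutator of `X` with `A`: on the right `X (A - e) = P A' S`
because `S (A - e) = 1 - P`, and on the left `(A - e) X = 0` because `X` maps into the ground line.
-/
theorem hasDerivWithinAt_inner_correction (hs : s ∈ Icc (0 : ℝ) 1) (hus : u s ∈ D)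
    (hu : HasDerivWithinAt u (-(Complex.I * (τ : ℂ)) • A s ⟨u s, hus⟩) (Icc 0 1) s) :
    HasDerivWithinAt (fun r => (inner ℂ (u r) (correction γ (ψ r) (G r) (K' r) (u r))).im)
      ((inner ℂ (u s) (correctionDeriv γ (ψ s) (G s) (K' s) (K'' s) (u s))).im - τ *
        (inner ℂ (u s) (stateProj (ψ s) (K' s (reducedResolvent γ (ψ s) (G s) (u s))))).re)
      (Icc 0 1) s := by
  have hg := h.ground s hs
  have h1 := hasDerivWithinAt_inner_clm (h.hasDerivWithinAt_correction hs) hu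
  refine (Complex.imCLM.hasFDerivAt.comp_hasDerivWithinAt s h1).congr_deriv ?_
  have hS : reducedResolvent γ (ψ s) (G s) (stateProj (ψ s) (u s)) = 0 :=
    DFunLike.congr_fun (hg.reducedResolvent_mul_stateProj h.gap_pos) (u s)
  have h2 : correction γ (ψ s) (G s) (K' s) (A s ⟨u s, hus⟩) =
      stateProj (ψ s) (K' s (reducedResolvent γ (ψ s) (G s) (u s))) +
      (e s : ℂ) • correction γ (ψ s) (G s) (K' s) (u s) := by
    change stateProj (ψ s) (K' s (reducedResolvent γ (ψ s) (G s)
      (reducedResolvent γ (ψ s) (G s) (A s ⟨u s, hus⟩)))) = _ + (e s : ℂ) • stateProj (ψ s) (K' s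
        (reducedResolvent γ (ψ s) (G s) (reducedResolvent γ (ψ s) (G s) (u s))))
    rw [hg.reducedResolvent_map h.gap_pos, map_add, map_sub, hS, sub_zero, map_smul, map_add,
      map_add, map_smul, map_smul]
  have h3 : inner ℂ (A s ⟨u s, hus⟩) (correction γ (ψ s) (G s) (K' s) (u s)) =
      (e s : ℂ) * inner ℂ (u s) (correction γ (ψ s) (G s) (K' s) (u s)) := by
    have := hg.symm ⟨u s, hus⟩ ⟨_, hg.stateProj_mem (K' s
        (reducedResolvent γ (ψ s) (G s) (reducedResolvent γ (ψ s) (G s) (u s))))⟩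
    rw [hg.map_stateProj, inner_smul_right] at this
    exact this
  rw [Complex.imCLM_apply, map_smul, h2, inner_smul_left, h3, inner_smul_right, inner_add_right,
    inner_smul_right]
  simp only [map_neg, map_mul, Complex.conj_I, Complex.conj_ofReal, Complex.add_im]
  simp only [Complex.mul_re, Complex.mul_im, Complex.neg_re, Complex.neg_im, Complex.I_re,
    Complex.I_im, Complex.ofReal_re, Complex.ofReal_im, Complex.add_re, Complex.add_im]
  ring

/-- The adiabatic theorem: a state that starts as the ground state and evolves slowly stays close
to the instantaneous ground state. -/
theorem norm_sub_stateProj_le (hτ : 0 < τ)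
    (hu : ∀ s ∈ Icc (0 : ℝ) 1, ∃ hus : u s ∈ D,
      HasDerivWithinAt u (-(Complex.I * (τ : ℂ)) • A s ⟨u s, hus⟩) (Icc 0 1) s)
    (hu1 : ∀ s ∈ Icc (0 : ℝ) 1, ‖u s‖ = 1) (hu0 : stateProj (ψ 0) (u 0) = u 0) :
    ‖u 1 - stateProj (ψ 1) (u 1)‖ ≤
      2 / τ * (γ⁻¹ ^ 2 * b₁ + (γ⁻¹ ^ 2 * b₂ + 24 * γ⁻¹ ^ 3 * b₁ ^ 2)) := by
  have h0mem : (0 : ℝ) ∈ Icc (0 : ℝ) 1 := left_mem_Icc.2 zero_le_one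
  have h1mem : (1 : ℝ) ∈ Icc (0 : ℝ) 1 := right_mem_Icc.2 zero_le_one
  set C := γ⁻¹ ^ 2 * b₂ + 24 * γ⁻¹ ^ 3 * b₁ ^ 2
  have hC : 0 ≤ C := (norm_nonneg _).trans (h.norm_correctionDeriv_le h0mem)
  have hcont : ContinuousOn (fun s => ‖u s - stateProj (ψ s) (u s)‖) (Icc 0 1) := fun s hs => by
    obtain ⟨hus, hd⟩ := hu s hs
    exact (hd.continuousWithinAt.sub (hasDerivWithinAt_clm_apply
      (h.hasDerivWithinAt_stateProj hs) hd).continuousWithinAt).norm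
  obtain ⟨t, ht, hmax⟩ := isCompact_Icc.exists_isMaxOn ⟨0, h0mem⟩ hcont
  set M := ‖u t - stateProj (ψ t) (u t)‖ with hM
  have hle : ∀ s ∈ Icc (0 : ℝ) 1, ‖u s - stateProj (ψ s) (u s)‖ ≤ M := hmax
  -- The weight `2 / τ` is chosen so that the terms `Re⟨u, P A' S u⟩` in the two derivatives cancel.
  let q : ℝ → ℝ := fun s => -(inner ℂ (u s) (stateProj (ψ s) (u s))).re +
    2 / τ * (inner ℂ (u s) (correction γ (ψ s) (G s) (K' s) (u s))).im
  have hq : ∀ s ∈ Icc (0 : ℝ) 1, HasDerivWithinAt q (2 / τ *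
      (inner ℂ (u s) (correctionDeriv γ (ψ s) (G s) (K' s) (K'' s) (u s))).im) (Icc 0 1) s := by
    intro s hs
    obtain ⟨hus, hd⟩ := hu s hs
    refine ((h.hasDerivWithinAt_inner_stateProj hs hus hd).neg.add
      ((h.hasDerivWithinAt_inner_correction hs hus hd).const_mul (2 / τ))).congr_deriv ?_
    field_simp
    ring
  have hmv := (convex_Icc (0 : ℝ) 1).norm_image_sub_le_of_norm_hasDerivWithin_le
    (C := 2 / τ * (C * M)) hq (fun s hs => by
      rw [norm_mul, Real.norm_of_nonneg (by positivity), Real.norm_eq_abs]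
      refine mul_le_mul_of_nonneg_left ?_ (by positivity)
      exact (h.abs_im_inner_correctionDeriv_le hs (hu1 s hs)).trans
        (mul_le_mul_of_nonneg_left (hle s hs) hC)) h0mem ht
  have hmv2 : |q t - q 0| ≤ 2 / τ * (C * M) := by
    refine hmv.trans (mul_le_of_le_one_right (by positivity) ?_)
    rw [sub_zero, Real.norm_of_nonneg ht.1]
    exact ht.2
  have hq0 : q 0 = -1 := by
    have a1 := norm_sub_stateProj_sq (ψ 0) (u 0)
    have a2 := h.abs_im_inner_correction_le h0mem (hu1 0 h0mem)
    rw [hu0, sub_self, norm_zero, mul_zero] at a2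
    rw [hu0, sub_self, norm_zero, hu1 0 h0mem] at a1
    have a3 := abs_nonpos_iff.1 a2
    simp only [q, hu0, a3]
    linarith
  have hqt := norm_sub_stateProj_sq (ψ t) (u t)
  rw [hu1 t ht, ← hM] at hqt
  have hct := h.abs_im_inner_correction_le ht (hu1 t ht)
  have hct2 := mul_le_mul_of_nonneg_left ((neg_abs_le _).trans' (neg_le_neg hct))
    (by positivity : 0 ≤ 2 / τ)
  -- Here `q t - q 0` equals `M²` plus the correction term at `t`, and both the increment of `q` and
  -- that term are linear in `M`.
  have hMM : M * M ≤ 2 / τ * (γ⁻¹ ^ 2 * b₁ + C) * M := by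
    have a1 := (le_abs_self _).trans hmv2
    rw [hq0] at a1
    simp only [q] at a1
    rw [← hM] at hct2
    nlinarith
  have hB : 0 ≤ γ⁻¹ ^ 2 * b₁ := (norm_nonneg _).trans (h.norm_correction_le h0mem)
  refine (hle 1 h1mem).trans ?_
  rcases (norm_nonneg (u t - stateProj (ψ t) (u t))).eq_or_lt with h0 | h0
  · rw [← hM] at h0
    rw [← h0]
    positivity
  · exact le_of_mul_le_mul_right hMM h0

end IsGappedFamily

end Adiabatic

/-! ### From operator-norm differentiability on `D` to a bounded perturbation. -/

namespace Adiabatic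

variable {E : Type*} [NormedAddCommGroup E] [InnerProductSpace ℂ E]

section Differentiability

variable {D : Submodule ℂ E} {H F : ℝ → D →ₗ[ℂ] E} {H' H'' F' F'' : ℝ → E →L[ℂ] E}

theorem HasOpDerivWithinAt.add {H' F' : E →L[ℂ] E} {J : Set ℝ} {s : ℝ}
    (hH : HasOpDerivWithinAt H H' J s) (hF : HasOpDerivWithinAt F F' J s) :
    HasOpDerivWithinAt (fun r => H r + F r) (H' + F') J s := fun ε hε => by
  filter_upwards [hH (ε / 2) (half_pos hε), hF (ε / 2) (half_pos hε)] with r h1 h2 x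
  have h3 : (H r + F r) x - (H s + F s) x - ((r - s : ℝ) : ℂ) • (H' + F') (x : E) =
      (H r x - H s x - ((r - s : ℝ) : ℂ) • H' (x : E)) +
      (F r x - F s x - ((r - s : ℝ) : ℂ) • F' (x : E)) := by
    simp only [LinearMap.add_apply, add_apply, smul_add]
    abel
  rw [h3]
  refine (norm_add_le _ _).trans ((add_le_add (h1 x) (h2 x)).trans_eq ?_)
  ring

theorem HasOpDerivWithinAt.comp_mul_right {H' : E →L[ℂ] E} {J J₁ : Set ℝ} {s τ : ℝ} (hτ : 0 < τ)
    (hJ : MapsTo (fun r => r * τ) J₁ J) (hH : HasOpDerivWithinAt H H' J (s * τ)) :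
    HasOpDerivWithinAt (fun r => H (r * τ)) (τ • H') J₁ s := fun ε hε => by
  have h1 : Tendsto (fun r => r * τ) (𝓝[J₁] s) (𝓝[J] (s * τ)) :=
    (by fun_prop : ContinuousWithinAt (fun r => r * τ) J₁ s).tendsto_nhdsWithin hJ
  filter_upwards [h1.eventually (hH (ε / τ) (div_pos hε hτ))] with r hr x
  refine (le_of_eq ?_).trans ((hr x).trans_eq ?_)
  · rw [← sub_mul, smul_apply, ← Complex.coe_smul τ, smul_smul, ← Complex.ofReal_mul]
  · rw [← sub_mul, abs_mul, abs_of_pos hτ]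
    field_simp

theorem HasOpDerivWithinAt.hasDerivWithinAt_apply {H' : E →L[ℂ] E} {J : Set ℝ} {s : ℝ}
    (hH : HasOpDerivWithinAt H H' J s) (x : D) :
    HasDerivWithinAt (fun r => H r x) (H' (x : E)) J s := by
  rw [hasDerivWithinAt_iff_isLittleO, Asymptotics.isLittleO_iff]
  intro c hc
  have hx : 0 < ‖(x : E)‖ + 1 := by positivity
  filter_upwards [hH (c / (‖(x : E)‖ + 1)) (div_pos hc hx)] with r hr
  refine (le_of_eq ?_).trans ((hr x).trans ?_)
  · rw [Complex.coe_smul]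
  · rw [Real.norm_eq_abs, div_mul_eq_mul_div, div_mul_eq_mul_div, div_le_iff₀ hx]
    have := mul_nonneg hc.le (abs_nonneg (r - s))
    nlinarith

theorem TwiceDiffBounded.add {J : Set ℝ} {b₁ b₂ c₁ c₂ : ℝ}
    (hH : TwiceDiffBounded H H' H'' J b₁ b₂) (hF : TwiceDiffBounded F F' F'' J c₁ c₂) :
    TwiceDiffBounded (fun r => H r + F r) (fun r => H' r + F' r) (fun r => H'' r + F'' r) J
      (b₁ + c₁) (b₂ + c₂) where
  hasDeriv s hs := (hH.hasDeriv s hs).add (hF.hasDeriv s hs)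
  hasDeriv₂ s hs := (hH.hasDeriv₂ s hs).add (hF.hasDeriv₂ s hs)
  norm_deriv_le s hs :=
    (norm_add_le _ _).trans (add_le_add (hH.norm_deriv_le s hs) (hF.norm_deriv_le s hs))
  norm_deriv₂_le s hs :=
    (norm_add_le _ _).trans (add_le_add (hH.norm_deriv₂_le s hs) (hF.norm_deriv₂_le s hs))

theorem TwiceDiffBounded.comp_mul_right {J J₁ : Set ℝ} {b₁ b₂ τ : ℝ} (hτ : 0 < τ)
    (hJ : MapsTo (fun r => r * τ) J₁ J) (hH : TwiceDiffBounded H H' H'' J b₁ b₂) :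
    TwiceDiffBounded (fun r => H (r * τ)) (fun r => τ • H' (r * τ))
      (fun r => τ • τ • H'' (r * τ)) J₁ (τ * b₁) (τ * (τ * b₂)) where
  hasDeriv s hs := (hH.hasDeriv _ (hJ hs)).comp_mul_right hτ hJ
  hasDeriv₂ s hs := by
    have h1 : HasDerivWithinAt (fun r => r * τ) τ J₁ s := by
      simpa using (hasDerivWithinAt_id s J₁).mul_const τ
    exact ((hH.hasDeriv₂ _ (hJ hs)).scomp s h1 hJ).const_smul τ
  norm_deriv_le s hs := by
    rw [norm_smul, Real.norm_of_nonneg hτ.le]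
    exact mul_le_mul_of_nonneg_left (hH.norm_deriv_le _ (hJ hs)) hτ.le
  norm_deriv₂_le s hs := by
    rw [norm_smul, norm_smul, Real.norm_of_nonneg hτ.le]
    exact mul_le_mul_of_nonneg_left (mul_le_mul_of_nonneg_left (hH.norm_deriv₂_le _ (hJ hs)) hτ.le)
      hτ.le

/-- Take `K` to be the integral of `H'`: for fixed `x` in `D`, the vector `H t x - K t x` has zero
derivative, so differences of the unbounded operators are differences of the bounded `K`. -/
theorem TwiceDiffBounded.exists_perturbation [CompleteSpace E] {b₁ b₂ : ℝ}
    (hH : TwiceDiffBounded H H' H'' (Icc 0 1) b₁ b₂) :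
    ∃ K : ℝ → E →L[ℂ] E, (∀ s ∈ Icc (0 : ℝ) 1, HasDerivWithinAt K (H' s) (Icc 0 1) s) ∧
      ∀ s ∈ Icc (0 : ℝ) 1, ∀ r ∈ Icc (0 : ℝ) 1, ∀ x : D, H r x = H s x + (K r - K s) x := by
  have hcont : ContinuousOn H' (Icc 0 1) := fun s hs => (hH.hasDeriv₂ s hs).continuousWithinAt
  have hB : Continuous (IccExtend (zero_le_one' ℝ) ((Icc (0 : ℝ) 1).domRestrict H')) :=
    hcont.domRestrict.Icc_extend'
  have hK : ∀ s ∈ Icc (0 : ℝ) 1, HasDerivWithinAt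
      (fun r => ∫ t in (0 : ℝ)..r, IccExtend (zero_le_one' ℝ) ((Icc (0 : ℝ) 1).domRestrict H') t)
      (H' s) (Icc 0 1) s := fun s hs => by
    have := (hB.integral_hasStrictDerivAt 0 s).hasDerivAt.hasDerivWithinAt (s := Icc (0 : ℝ) 1)
    rwa [IccExtend_of_mem _ _ hs] at this
  refine ⟨_, hK, fun s hs r hr x => ?_⟩
  set K := fun r => ∫ t in (0 : ℝ)..r, IccExtend (zero_le_one' ℝ) ((Icc (0 : ℝ) 1).domRestrict H') t
  have hd : ∀ t ∈ Icc (0 : ℝ) 1, HasDerivWithinAt (fun t => H t x - K t (x : E)) 0 (Icc 0 1) t :=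
    fun t ht => by
      have h1 := hasDerivWithinAt_clm_apply (hK t ht)
        (hasDerivWithinAt_const t (Icc (0 : ℝ) 1) (x : E))
      refine (((hH.hasDeriv t ht).hasDerivWithinAt_apply x).sub h1).congr_deriv ?_
      rw [map_zero, add_zero, sub_self]
  have hc := (convex_Icc (0 : ℝ) 1).norm_image_sub_le_of_norm_hasDerivWithin_le (C := 0) hd
    (fun t _ => by rw [norm_zero]) hs hr
  rw [zero_mul, norm_le_zero_iff, sub_eq_zero, sub_eq_iff_eq_add] at hc
  rw [hc, sub_apply]
  abel

end Differentiability

/-! ### Exchanging the initial and target states. -/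

section Deviation

theorem stateDeviation_eq_norm {ψ φ : E} (hψ : ‖ψ‖ = 1) (hφ : ‖φ‖ = 1) :
    stateDeviation ψ φ = ‖φ - stateProj ψ φ‖ := by
  have h := norm_sub_stateProj_sq ψ φ
  rw [stateProj_apply hψ, inner_smul_right, hφ, ← inner_conj_symm φ ψ, Complex.mul_conj',
    ← stateProj_apply hψ] at h
  rw [stateDeviation, ← Real.sqrt_sq (norm_nonneg (φ - stateProj ψ φ)), h]
  congr 1
  rw [one_pow]
  norm_cast

theorem stateDeviation_comm (ψ φ : E) : stateDeviation ψ φ = stateDeviation φ ψ := by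
  rw [stateDeviation, stateDeviation, norm_inner_symm]

/-- Replacing the initial and the target state changes the transition error by at most the
deviations of these states. -/
theorem norm_transition_le {φ₀ φ₁ ψ₀ ψ₁ : E} (hφ₀ : ‖φ₀‖ = 1) (hφ₁ : ‖φ₁‖ = 1) (hψ₀ : ‖ψ₀‖ = 1)
    (hψ₁ : ‖ψ₁‖ = 1) {V : E →L[ℂ] E} (hV : ∀ x, ‖V x‖ = ‖x‖) :
    ‖(1 - stateProj φ₁) * V * stateProj φ₀‖ ≤
      ‖V ψ₀ - stateProj ψ₁ (V ψ₀)‖ + stateDeviation ψ₀ φ₀ + stateDeviation ψ₁ φ₁ := by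
  set Δ := ‖V ψ₀ - stateProj ψ₁ (V ψ₀)‖
  have hQ : ∀ x, ‖(1 - stateProj φ₁) x‖ ≤ ‖x‖ := fun x => by
    have := ContinuousLinearMap.le_of_opNorm_le _ (norm_one_sub_stateProj_le φ₁) x
    rwa [one_mul] at this
  have hu : ∀ {x y : E}, ‖x‖ = 1 → ‖y‖ = 1 → ‖inner ℂ x y‖ ≤ 1 := fun {x y} hx hy => by
    have := norm_inner_le_norm (𝕜 := ℂ) x y
    rwa [hx, hy, one_mul] at this
  have hψ₁Q : ‖(1 - stateProj φ₁) ψ₁‖ = stateDeviation ψ₁ φ₁ := by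
    rw [stateDeviation_comm, stateDeviation_eq_norm hφ₁ hψ₁]
    rfl
  have hVψ : ‖(1 - stateProj φ₁) (V ψ₀)‖ ≤ Δ + stateDeviation ψ₁ φ₁ := by
    have h1 : V ψ₀ = (V ψ₀ - stateProj ψ₁ (V ψ₀)) + inner ℂ ψ₁ (V ψ₀) • ψ₁ := by
      rw [← stateProj_apply hψ₁, sub_add_cancel]
    calc ‖(1 - stateProj φ₁) (V ψ₀)‖
        = ‖(1 - stateProj φ₁) (V ψ₀ - stateProj ψ₁ (V ψ₀)) +
            inner ℂ ψ₁ (V ψ₀) • (1 - stateProj φ₁) ψ₁‖ := by rw [← map_smul, ← map_add, ← h1]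
      _ ≤ Δ + stateDeviation ψ₁ φ₁ := by
        refine (norm_add_le _ _).trans (add_le_add (hQ _) ?_)
        rw [norm_smul, hψ₁Q]
        exact mul_le_of_le_one_left (Real.sqrt_nonneg _) (hu hψ₁ ((hV _).trans hψ₀))
  have hVφ : ‖(1 - stateProj φ₁) (V φ₀)‖ ≤ Δ + stateDeviation ψ₀ φ₀ + stateDeviation ψ₁ φ₁ := by
    -- The first summand has norm equal to the deviation, which `V` preserves; the coefficient of
    -- `ψ₀` has modulus at most `1`. The costs therefore add, without a product term.
    have h1 : φ₀ = (φ₀ - stateProj ψ₀ φ₀) + inner ℂ ψ₀ φ₀ • ψ₀ := by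
      rw [← stateProj_apply hψ₀, sub_add_cancel]
    calc ‖(1 - stateProj φ₁) (V φ₀)‖
        = ‖(1 - stateProj φ₁) (V (φ₀ - stateProj ψ₀ φ₀)) +
            inner ℂ ψ₀ φ₀ • (1 - stateProj φ₁) (V ψ₀)‖ := by
          rw [← map_smul, ← map_smul, ← map_add, ← map_add, ← h1]
      _ ≤ stateDeviation ψ₀ φ₀ + (Δ + stateDeviation ψ₁ φ₁) := by
        refine (norm_add_le _ _).trans (add_le_add ?_ ?_)
        · rw [stateDeviation_eq_norm hψ₀ hφ₀]
          exact (hQ _).trans (hV _).le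
        · rw [norm_smul]
          exact (mul_le_of_le_one_left (norm_nonneg _) (hu hψ₀ hφ₀)).trans hVψ
      _ = _ := by ring
  refine ContinuousLinearMap.opNorm_le_bound _ ((norm_nonneg _).trans hVφ) fun x => ?_
  change ‖(1 - stateProj φ₁) (V (stateProj φ₀ x))‖ ≤ _
  rw [stateProj_apply hφ₀, map_smul, map_smul, norm_smul, mul_comm]
  refine mul_le_mul hVφ ?_ (norm_nonneg _) ((norm_nonneg _).trans hVφ)
  have := norm_inner_le_norm (𝕜 := ℂ) φ₀ x
  rwa [hφ₀, one_mul] at this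

end Deviation

/-- The error estimate for run-time `τ` in terms of bounds on the derivatives. -/
theorem adiabatic_error_le_noiseBound {c₁ c₂ d₁ d₂ γ δ₀ δ₁ τ : ℝ} (hγ : 0 < γ) (hτ : 0 < τ)
    (hc₁ : 0 ≤ c₁) (hc₂ : 0 ≤ c₂) (hd₁ : 0 ≤ d₁) (hd₂ : 0 ≤ d₂) (hδ₀ : 0 ≤ δ₀) (hδ₁ : 0 ≤ δ₁) :
    2 / τ * (γ⁻¹ ^ 2 * (c₁ + τ * d₁) +
      (γ⁻¹ ^ 2 * (c₂ + τ * (τ * d₂)) + 24 * γ⁻¹ ^ 3 * (c₁ + τ * d₁) ^ 2)) + δ₀ + δ₁ ≤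
      noiseBound c₁ c₂ d₁ d₂ γ δ₀ δ₁ τ := by
  -- In these variables the stated bound has coefficients `8`, `4`, `64` against `1`, `1`, `24` in
  -- the estimate, and the extra term `δ₀ * δ₁`.
  have h1 : noiseBound c₁ c₂ d₁ d₂ γ δ₀ δ₁ τ = 2 / τ * (8 * (γ⁻¹ ^ 2 * (c₁ + τ * d₁)) +
      (4 * (γ⁻¹ ^ 2 * (c₂ + τ * (τ * d₂))) + 64 * γ⁻¹ ^ 3 * (c₁ + τ * d₁) ^ 2)) + δ₀ + δ₁ +
      δ₀ * δ₁ := by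
    rw [noiseBound]
    field_simp
    ring
  rw [h1]
  have h2 : 0 ≤ δ₀ * δ₁ := mul_nonneg hδ₀ hδ₁
  have h3 : 0 ≤ γ⁻¹ ^ 2 * (c₁ + τ * d₁) := by positivity
  have h4 : 0 ≤ γ⁻¹ ^ 2 * (c₂ + τ * (τ * d₂)) := by positivity
  have h5 : 0 ≤ γ⁻¹ ^ 3 * (c₁ + τ * d₁) ^ 2 := by positivity
  have h6 := mul_le_mul_of_nonneg_left (show γ⁻¹ ^ 2 * (c₁ + τ * d₁) +
      (γ⁻¹ ^ 2 * (c₂ + τ * (τ * d₂)) + 24 * γ⁻¹ ^ 3 * (c₁ + τ * d₁) ^ 2) ≤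
      8 * (γ⁻¹ ^ 2 * (c₁ + τ * d₁)) +
      (4 * (γ⁻¹ ^ 2 * (c₂ + τ * (τ * d₂))) + 64 * γ⁻¹ ^ 3 * (c₁ + τ * d₁) ^ 2) by linarith)
    (show 0 ≤ 2 / τ by positivity)
  linarith

theorem runtime_bounds {c₁ c₂ d₁ d₂ γ δ₀ δ₁ τ ε : ℝ} (hγ : 0 < γ) (hτ : 0 < τ)
    (hc₁ : 0 ≤ c₁) (hc₂ : 0 ≤ c₂) (hd₁ : 0 ≤ d₁) (hd₂ : 0 ≤ d₂) (hδ₀ : 0 ≤ δ₀) (hδ₁ : 0 ≤ δ₁)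
    (hε : noiseBound c₁ c₂ d₁ d₂ γ δ₀ δ₁ τ ≤ ε) :
    8 / γ ^ 2 * (2 * c₁ + c₂ + 16 * c₁ ^ 2 / γ) ≤ ε * τ ∧
      8 / γ ^ 2 * (d₂ + 16 * d₁ ^ 2 / γ) * τ ≤ ε := by
  rw [noiseBound, mul_add, mul_add] at hε
  have h1 : 0 ≤ 8 / γ ^ 2 * ((d₂ + 16 * d₁ ^ 2 / γ) * τ) := by positivity
  have h2 : 0 ≤ 8 / γ ^ 2 * (2 * d₁ * (1 + 16 * c₁ / γ)) := by positivity
  have h3 : 0 ≤ 8 / γ ^ 2 * ((2 * c₁ + c₂ + 16 * c₁ ^ 2 / γ) * (1 / τ)) := by positivity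
  have h4 : 0 ≤ δ₀ * δ₁ := mul_nonneg hδ₀ hδ₁
  constructor
  · rw [← div_le_iff₀ hτ, div_eq_mul_one_div, mul_assoc]
    linarith
  · rw [mul_assoc]
    linarith

end Adiabatic

theorem mainTheorem5 {E : Type*} [NormedAddCommGroup E] [InnerProductSpace ℂ E] [CompleteSpace E]
    (D : Submodule ℂ E) (hD : Dense (D : Set E))
    -- the intended Hamiltonian and the noise Hamiltonian, on a common dense domain
    (H Hnoise : ℝ → D →ₗ[ℂ] E)
    -- the run-times under consideration
    (T : Set ℝ) (hT : T ⊆ Ioi 0)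
    -- bounds on the first two derivatives
    (c₁ c₂ d₁ d₂ : ℝ) (H' H'' Hnoise' Hnoise'' : ℝ → E →L[ℂ] E)
    (hH : Adiabatic.TwiceDiffBounded H H' H'' (Icc 0 1) c₁ c₂)
    (hnoise : Adiabatic.TwiceDiffBounded Hnoise Hnoise' Hnoise'' (Adiabatic.realTimes T) d₁ d₂)
    -- the Hamiltonians are self-adjoint
    (hHsa : ∀ s ∈ Icc (0 : ℝ) 1, IsSelfAdjoint (LinearPMap.mk D (H s)))
    (hHτsa : ∀ τ ∈ T, ∀ s ∈ Icc (0 : ℝ) 1,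
      IsSelfAdjoint (LinearPMap.mk D (Adiabatic.noisyHamiltonian H Hnoise τ s)))
    -- the noisy Hamiltonians have a complete set of eigenstates, with a uniform gap
    (spec : ∀ τ ∈ T, ∀ s ∈ Icc (0 : ℝ) 1,
      Adiabatic.OrderedEigenbasis (Adiabatic.noisyHamiltonian H Hnoise τ s))
    (γ : ℝ) (hγ : 0 < γ)
    (hgap : ∀ (τ : ℝ) (hτ : τ ∈ T) (s : ℝ) (hs : s ∈ Icc (0 : ℝ) 1), γ ≤ (spec τ hτ s hs).gap)
    -- the ground states of the intended Hamiltonian at the two endpoints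
    (φ₀ φ₁ : E) (hφ₀ : Adiabatic.IsGroundState (H 0) φ₀) (hφ₁ : Adiabatic.IsGroundState (H 1) φ₁)
    -- their deviation from the ground states of the noisy Hamiltonian
    (δ₀ δ₁ : ℝ → ℝ)
    (hδ₀ : ∀ (τ : ℝ) (hτ : τ ∈ T), δ₀ τ =
      Adiabatic.stateDeviation (spec τ hτ 0 (left_mem_Icc.mpr zero_le_one)).ground φ₀)
    (hδ₁ : ∀ (τ : ℝ) (hτ : τ ∈ T), δ₁ τ =
      Adiabatic.stateDeviation (spec τ hτ 1 (right_mem_Icc.mpr zero_le_one)).ground φ₁)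
    -- the unitary evolution operators of the noisy Hamiltonians
    (U : ℝ → ℝ → E →L[ℂ] E)
    (hU : ∀ τ ∈ T, Adiabatic.IsEvolution τ (Adiabatic.noisyHamiltonian H Hnoise τ) (U τ)) :
    ∀ τ ∈ T,
      ‖(1 - Adiabatic.stateProj φ₁) * U τ 1 * Adiabatic.stateProj φ₀‖
          ≤ Adiabatic.noiseBound c₁ c₂ d₁ d₂ γ (δ₀ τ) (δ₁ τ) τ ∧
      ∀ ε : ℝ, Adiabatic.noiseBound c₁ c₂ d₁ d₂ γ (δ₀ τ) (δ₁ τ) τ ≤ ε →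
        8 / γ ^ 2 * (2 * c₁ + c₂ + 16 * c₁ ^ 2 / γ) ≤ ε * τ ∧
        8 / γ ^ 2 * (d₂ + 16 * d₁ ^ 2 / γ) * τ ≤ ε := by
  intro τ hτT
  have hτ : 0 < τ := hT hτT
  have h0 : (0 : ℝ) ∈ Icc (0 : ℝ) 1 := left_mem_Icc.mpr zero_le_one
  have h1 : (1 : ℝ) ∈ Icc (0 : ℝ) 1 := right_mem_Icc.mpr zero_le_one
  have hmaps : MapsTo (fun r => r * τ) (Icc 0 1) (Adiabatic.realTimes T) := fun r hr =>
    mem_biUnion hτT ⟨mul_nonneg hr.1 hτ.le, mul_le_of_le_one_left hτ.le hr.2⟩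
  have hc₁ : 0 ≤ c₁ := (norm_nonneg _).trans (hH.norm_deriv_le 0 h0)
  have hc₂ : 0 ≤ c₂ := (norm_nonneg _).trans (hH.norm_deriv₂_le 0 h0)
  have hd₁ : 0 ≤ d₁ := (norm_nonneg _).trans (hnoise.norm_deriv_le _ (hmaps h0))
  have hd₂ : 0 ≤ d₂ := (norm_nonneg _).trans (hnoise.norm_deriv₂_le _ (hmaps h0))
  have hδ₀0 : 0 ≤ δ₀ τ := (Real.sqrt_nonneg _).trans_eq (hδ₀ τ hτT).symm
  have hδ₁0 : 0 ≤ δ₁ τ := (Real.sqrt_nonneg _).trans_eq (hδ₁ τ hτT).symm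
  refine ⟨?_, fun ε hε => Adiabatic.runtime_bounds hγ hτ hc₁ hc₂ hd₁ hd₂ hδ₀0 hδ₁0 hε⟩
  refine le_trans ?_ (Adiabatic.adiabatic_error_le_noiseBound hγ hτ hc₁ hc₂ hd₁ hd₂ hδ₀0 hδ₁0)
  have hdiff := hH.add (hnoise.comp_mul_right hτ hmaps)
  obtain ⟨K, hK, hKmap⟩ := hdiff.exists_perturbation
  have hres : ∀ s : Icc (0 : ℝ) 1, ∃ (e : ℝ) (ψ : E) (G : E →L[ℂ] E),
      ψ = (spec τ hτT s s.2).ground ∧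
      Adiabatic.IsGroundResolvent (Adiabatic.noisyHamiltonian H Hnoise τ s) γ e ψ G := fun s => by
    obtain ⟨G, hG⟩ := (spec τ hτT s s.2).exists_isGroundResolvent (hHτsa τ hτT s s.2) hγ
      (hgap τ hτT s s.2)
    exact ⟨_, _, G, rfl, hG⟩
  choose e ψ G hψ hG using hres
  have hfam : Adiabatic.IsGappedFamily (Adiabatic.noisyHamiltonian H Hnoise τ) γ (c₁ + τ * d₁)
      -- The data `e`, `ψ`, `G` exist only on `[0,1]`; `projIcc` extends them by their endpoint
      -- values to functions on `ℝ`.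
      (c₂ + τ * (τ * d₂)) K (fun r => H' r + τ • Hnoise' (r * τ))
      (fun r => H'' r + τ • τ • Hnoise'' (r * τ)) (fun s => e (projIcc 0 1 zero_le_one s))
      (fun s => ψ (projIcc 0 1 zero_le_one s)) (fun s => G (projIcc 0 1 zero_le_one s)) :=
    { gap_pos := hγ
      dense := hD
      ground := fun s hs => by
        rw [projIcc_of_mem zero_le_one hs]
        exact hG ⟨s, hs⟩
      map_eq := hKmap
      hasDeriv := hK
      hasDeriv₂ := hdiff.hasDeriv₂
      norm_deriv_le := hdiff.norm_deriv_le
      norm_deriv₂_le := hdiff.norm_deriv₂_le }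
  have hnorm : ∀ s ∈ Icc (0 : ℝ) 1, ∀ x, ‖U τ s x‖ = ‖x‖ := fun s hs x =>
    ContinuousLinearMap.norm_map_of_mem_unitary ((hU τ hτT).unitary s hs) x
  have hg0 := hG ⟨0, h0⟩
  have hg1 := hG ⟨1, h1⟩
  have hmain := hfam.norm_sub_stateProj_le (u := fun s => U τ s (ψ ⟨0, h0⟩)) hτ
    (fun s hs => (hU τ hτT).schrodinger s hs _ hg0.ground_mem)
    (fun s hs => (hnorm s hs _).trans hg0.norm_ground) (by
      rw [(hU τ hτT).zero, projIcc_of_mem zero_le_one h0]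
      exact Adiabatic.stateProj_self _)
  rw [projIcc_of_mem zero_le_one h1] at hmain
  have htrans := Adiabatic.norm_transition_le hφ₀.1 hφ₁.1 hg0.norm_ground hg1.norm_ground
    (hnorm 1 h1)
  rw [hδ₀ τ hτT, hδ₁ τ hτT, ← hψ ⟨0, h0⟩, ← hψ ⟨1, h1⟩]
  linarith
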